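/- Let $E\subset\mathbb R^n$ be compact and such that every nonempty relatively open subset of $E$ has positive Lebesgue measure (e.g. $n=2$ and $E=[0,1]^2$). Let $k:E\times E\to\mathbb R$ be a continuous (hence bounded) kernel and $H_k$ its reproducing kernel Hilbert space, i.e. the Hilbert space of functions on $E$ with $k(\cdot,x)\in H_k$ and $f(x)=\langle k(\cdot,x),f\rangle_k$ for all $x\in E$, $f\in H_k$. Let $\mathcal K=\sum_{q\ge1}\lambda_q\,e_q\otimes e_q$ be a spectral decomposition of the integral operator $(\mathcal Kf)(x)=\int_E k(x,y)f(y)\,dy$ on $L^2(E)$: the eigenvalues $\lambda_1\ge\lambda_2\ge\cdots$ are listed with multiplicity (followed by zeros if $\mathcal K$ has finite rank), and the $e_q$ with $\lambda_q\neq0$ are $L^2$-orthonormal eigenfunctions, chosen so that $\mathcal Ke_q=\lambda_qe_q$ holds at every point of $E$. All sums below run over the $q$ with $\lambda_q\ne0$. (1) The functions $\sqrt{\lambda_q}\,e_q$ form an orthonormal basis of $H_k$. Every $\chi\in H_k$ has a unique expansion $$\chi=\sum_q\mu_q\,\sqrt{\lambda_q}\,e_q ,$$ convergent in $H_k$ and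 also at every point of $E$. (2) If $\chi_i=\sum_q\mu_{qi}\sqrt{\lambda_q}e_q$ and $\chi_j=\sum_q\mu_{qj}\sqrt{\lambda_q}e_q$ in $H_k$, then $\langle\chi_i,\chi_j\rangle_k=\sum_q\mu_{qi}\mu_{qj}$. (3) For points $a=(a_1,\dots,a_N)$ of $E$ let $K|_a=(k(a_i,a_j))_{i,j\le N}$. Then $\lambda_q\neq0$ for all $q\le d=\operatorname{rank}(K|_a)$. Let $a^{(m)}=(a^{(m)}_1,\dots,a^{(m)}_{N_m})$, $m\ge1$, be grids in $E$ which become uniformly distributed, i.e. $\frac1{N_m}\sum_l g(a^{(m)}_l)\to\frac1{|E|}\int_E g$ for all continuous $g:E\to\mathbb R$. Let $d_m=\operatorname{rank}(K|_{a^{(m)}})$ and let $(\ell^{(m)}_q,v^{(m)}_q)_{q\le N_m}$ be the eigenpairs of $K|_{a^{(m)}}$, with $\ell^{(m)}_1\ge\ell^{(m)}_2\ge\cdots$ and the $v^{(m)}_q$ orthonormal. Then there are spectral decompositions $\mathcal K=\sum_q\lambda_q\,e^{(m)}_q\otimes e^{(m)}_q$ of the same kind, with $e^{(m)}_q=\pm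 e_q$ whenever $\lambda_q\neq0$ is a simple eigenvalue, such that for every $q$ with $\lambda_q\ne0$: one has $q\le d_m$ for all large $m$, and for every $\varepsilon>0$ there is $m_0$ such that for all $m\ge m_0$ and all $\beta\in\mathbb R^{N_m}$ the function $\chi=\sum_{l}\beta_l\,k(\cdot,a^{(m)}_l)$, with expansion $\chi=\sum_q\mu_q\sqrt{\lambda_q}\,e^{(m)}_q$, satisfies $$\Bigl|\,\mu_q-\sqrt{\ell^{(m)}_q}\,\bigl(v^{(m)}_q\cdot\beta\bigr)\Bigr|\le\varepsilon\,\|\chi\|_k .$$ -/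

import Mathlib

open MeasureTheory Filter Topology
open scoped InnerProductSpace Matrix

noncomputable section

/-- `k` is the reproducing kernel of the Hilbert space `H` of real functions on `X`: for every `x`
the function `k(·, x)` belongs to `H`, and `f x = ⟨k(·, x), f⟩` for all `f` in `H`. -/
def IsReproducingKernel {X : Type*} (H : Type*) [NormedAddCommGroup H] [InnerProductSpace ℝ H]
    [RKHS ℝ H X ℝ] (k : X → X → ℝ) : Prop :=
  ∀ x : X, ∃ g : H, (∀ y, g y = k y x) ∧ ∀ f : H, f x = ⟪g, f⟫_ℝ

/-- Lebesgue measure on a subset `E` of `ℝⁿ`, as a measure on the subtype. -/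
abbrev lebesgueOn {n : ℕ} (E : Set (EuclideanSpace ℝ (Fin n))) : Measure E :=
  Measure.comap Subtype.val volume

/-- The integral operator with kernel `k` on functions on a measure space `(X, ν)`. -/
def integralOperator {X : Type*} [MeasurableSpace X] (ν : Measure X) (k : X → X → ℝ) (f : X → ℝ)
    (x : X) : ℝ :=
  ∫ y, k x y * f y ∂ν

/-- `(ev q, e q)`, `q = 0, 1, 2, …`, is a spectral decomposition `𝒦 = ∑ ev q • e q ⊗ e q` of the
integral operator `𝒦` of `k` on `L²(ν)`. The eigenvalues are listed in nonincreasing order with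
multiplicity; if `𝒦` has finite rank the list is filled up with zeros. The `e q` with `ev q ≠ 0` are
square integrable orthonormal eigenfunctions, normalized to satisfy the eigenvalue equation at
every point; the `e q` with `ev q = 0` play no role. -/
structure IsSpectralDecomposition {X : Type*} [MeasurableSpace X] (ν : Measure X)
    (k : X → X → ℝ) (ev : ℕ → ℝ) (e : ℕ → X → ℝ) : Prop where
  antitone : Antitone ev
  memLp : ∀ q, ev q ≠ 0 → MemLp (e q) 2 ν
  eigen : ∀ q, ev q ≠ 0 → ∀ x, integralOperator ν k (e q) x = ev q * e q x
  orthonormal : ∀ p q, ev p ≠ 0 → ev q ≠ 0 → ∫ x, e p x * e q x ∂ν = if p = q then 1 else 0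
  decomposition : ∀ f : X → ℝ, MemLp f 2 ν →
    Tendsto (fun Q : ℕ => eLpNorm (fun x => integralOperator ν k f x -
      ∑ q ∈ Finset.range Q, ev q * (∫ y, e q y * f y ∂ν) * e q x) 2 ν) atTop (𝓝 0)

/-- The indices of the nonzero eigenvalues. -/
abbrev NonzeroIndex (ev : ℕ → ℝ) : Type := {q : ℕ // ev q ≠ 0}

/-- `χ = ∑ q, μ q • (√(ev q) • e q)` in `H`, the sum being over the nonzero eigenvalues. -/
def HasExpansion {X : Type*} {H : Type*} [NormedAddCommGroup H] [InnerProductSpace ℝ H]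
    [RKHS ℝ H X ℝ] (ev : ℕ → ℝ) (e : ℕ → X → ℝ) (χ : H) (μ : NonzeroIndex ev → ℝ) : Prop :=
  ∃ u : NonzeroIndex ev → H, (∀ q x, u q x = √(ev q) * e q x) ∧ HasSum (fun q => μ q • u q) χ

/-- The Gram matrix of the kernel `k` at the points `a`. -/
def kernelMatrix {X : Type*} (k : X → X → ℝ) {N : ℕ} (a : Fin N → X) :
    Matrix (Fin N) (Fin N) ℝ :=
  Matrix.of fun i j => k (a i) (a j)

/-- `(ℓ q, v q)` are the eigenpairs of the matrix `A`: the eigenvalues in nonincreasing order with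
multiplicity, and an orthonormal basis of eigenvectors. -/
structure IsEigensystem {N : ℕ} (A : Matrix (Fin N) (Fin N) ℝ) (ℓ : Fin N → ℝ)
    (v : Fin N → Fin N → ℝ) : Prop where
  antitone : Antitone ℓ
  eigen : ∀ q, A *ᵥ v q = ℓ q • v q
  orthonormal : ∀ p q, v p ⬝ᵥ v q = if p = q then 1 else 0

/-- The grids `a m` become uniformly distributed in `X`: averages of continuous functions over
the grid converge to the average over `X`. -/
def IsEquidistributed {X : Type*} [TopologicalSpace X] [MeasurableSpace X] (ν : Measure X)
    {N : ℕ → ℕ} (a : ∀ m, Fin (N m) → X) : Prop :=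
  ∀ g : X → ℝ, Continuous g →
    Tendsto (fun m => (N m : ℝ)⁻¹ * ∑ l, g (a m l)) atTop
      (𝓝 ((ν.real Set.univ)⁻¹ * ∫ x, g x ∂ν))

end

/-! Write `φ x = k(·, x)`, a continuous map into `H`, let `S f = ∫ f φ` be its synthesis operator,
and note `(S* h)(x) = ⟪φ x, h⟫ = h x`. Then `𝒦 = S* S`, while the covariance operator `T = S S*`
acts on `H`. Hence `√λ_q e_q = λ_q^{-1/2} S e_q` are orthonormal eigenvectors of `T`. They are
complete: if `h` is orthogonal to all of them, then `f = S* h` satisfies `𝒦 f = 0`, so `S f = 0`, so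
`∫ f² = ⟪h, S f⟫ = 0`, and `h = 0` because the measure has full support. Expansions, inner products
and the rank bound follow from this basis.

The same duality on a grid, with `V β = ∑ β_l φ(a_l)`, makes the Gram matrix `V* V`, and `T_m =
(|E|/N_m) V V*` has the eigenvalues `|E| ℓ_q / N_m` with unit eigenvectors `w_q = ℓ_q^{-1/2} V v_q`
when `ℓ_q > 0`. The coefficient of `χ = V β` along `w_q` is exactly `√ℓ_q (v_q · β)`.

Equidistribution gives `T_m → T` in operator norm. Weyl's inequality (`abs_sub_eigenvalue_le`) then
gives convergence of eigenvalues, and the spectral gaps force `w_q` towards the eigenspace of `λ_q`.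
Inside each finite-dimensional eigenspace the basis is rotated by an orthogonal matrix to follow the
`w_q` (`exists_rotation_of_tendsto`). Cauchy–Schwarz turns closeness of the basis vectors into the
bound `ε ‖χ‖`, uniformly in `β`. -/

/-! ### Min-max comparison and spectral gaps in a Hilbert space. -/

section Hilbert

variable {ι H : Type*} [NormedAddCommGroup H] [InnerProductSpace ℝ H]

theorem HilbertBasis.hasSum_inner_sq (b : HilbertBasis ι ℝ H) (x : H) :
    HasSum (fun i => ⟪b i, x⟫_ℝ ^ 2) (‖x‖ ^ 2) := by
  have h := b.hasSum_inner_mul_inner x x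
  rw [real_inner_self_eq_norm_sq] at h
  refine h.congr_fun fun i => ?_
  rw [real_inner_comm x (b i), sq]

theorem Orthonormal.norm_sum_smul_sq [Fintype ι] {u : ι → H} (hu : Orthonormal ℝ u) (c : ι → ℝ) :
    ‖∑ i, c i • u i‖ ^ 2 = ∑ i, c i ^ 2 := by
  classical
  rw [← real_inner_self_eq_norm_sq, hu.inner_sum]
  simp [sq]

/-- The comparison at the heart of the min-max principle. -/
theorem le_add_norm_sub_of_orthonormal_eigenvectors {q : ℕ} {A B : H →L[ℝ] H}
    {u : Fin (q + 1) → H} (hu : Orthonormal ℝ u) {α : Fin (q + 1) → ℝ}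
    (hA : ∀ i, A (u i) = α i • u i) {a β : ℝ} (ha : ∀ i, a ≤ α i) (z : Fin q → H)
    (hB : ∀ x, (∀ i, ⟪z i, x⟫_ℝ = 0) → ⟪x, B x⟫_ℝ ≤ β * ‖x‖ ^ 2) :
    a ≤ β + ‖A - B‖ := by
  classical
  let f : (Fin (q + 1) → ℝ) →ₗ[ℝ] (Fin q → ℝ) :=
    LinearMap.pi fun i => (innerₛₗ ℝ (z i)) ∘ₗ Fintype.linearCombination ℝ u
  -- There are `q + 1` coefficients and only `q` orthogonality conditions.
  have hker : LinearMap.ker f ≠ ⊥ := LinearMap.ker_ne_bot_of_finrank_lt (by simp)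
  obtain ⟨c, hc, hc0⟩ := Submodule.exists_mem_ne_zero_of_ne_bot hker
  set x : H := ∑ i, c i • u i with hx
  have hz : ∀ i, ⟪z i, x⟫_ℝ = 0 := fun i => by
    have := congrFun (LinearMap.mem_ker.1 hc) i
    simpa [f, Fintype.linearCombination_apply, hx] using this
  have hnorm : ‖x‖ ^ 2 = ∑ i, c i ^ 2 := hu.norm_sum_smul_sq c
  have hpos : 0 < ‖x‖ ^ 2 := by
    rw [hnorm]
    obtain ⟨i, hi⟩ := Function.ne_iff.1 hc0
    exact Finset.sum_pos' (fun i _ => sq_nonneg _) ⟨i, Finset.mem_univ _, by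
      have : c i ≠ 0 := hi
      positivity⟩
  have hAx : A x = ∑ i, (c i * α i) • u i := by
    simp [hx, map_sum, hA, smul_smul]
  have h1 : a * ‖x‖ ^ 2 ≤ ⟪x, A x⟫_ℝ := by
    rw [hAx, hx, hu.inner_sum, ← hx, hnorm, Finset.mul_sum]
    refine Finset.sum_le_sum fun i _ => ?_
    simp only [conj_trivial]
    nlinarith [mul_le_mul_of_nonneg_right (ha i) (sq_nonneg (c i))]
  have h2 : ⟪x, A x⟫_ℝ - ⟪x, B x⟫_ℝ ≤ ‖A - B‖ * ‖x‖ ^ 2 := by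
    rw [← inner_sub_right, ← _root_.sub_apply]
    calc ⟪x, (A - B) x⟫_ℝ ≤ ‖x‖ * ‖(A - B) x‖ := real_inner_le_norm _ _
      _ ≤ ‖x‖ * (‖A - B‖ * ‖x‖) := by gcongr; exact (A - B).le_opNorm x
      _ = _ := by ring
  have h3 := hB x hz
  have : a * ‖x‖ ^ 2 ≤ (β + ‖A - B‖) * ‖x‖ ^ 2 := by nlinarith
  exact le_of_mul_le_mul_right this hpos

/-- An approximate eigenvector of a diagonal operator is close to the span of the basis vectors
whose eigenvalues are not bounded away from the approximate eigenvalue. -/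
theorem norm_sub_sum_le_of_spectral_gap (b : HilbertBasis ι ℝ H) {Λ : ι → ℝ} {A B : H →L[ℝ] H}
    (hA : ∀ p x, ⟪b p, A x⟫_ℝ = Λ p * ⟪b p, x⟫_ℝ) {w : H} {θ : ℝ} (hB : B w = θ • w)
    {C : Finset ι} {γ : ℝ} (hγ : 0 ≤ γ) (hgap : ∀ p, p ∉ C → γ ≤ |Λ p - θ|) :
    γ * ‖w - ∑ p ∈ C, ⟪b p, w⟫_ℝ • b p‖ ≤ ‖A - B‖ * ‖w‖ := by
  classical
  set r := w - ∑ p ∈ C, ⟪b p, w⟫_ℝ • b p with hr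
  have hbr : ∀ p, ⟪b p, r⟫_ℝ = if p ∈ C then 0 else ⟪b p, w⟫_ℝ := fun p => by
    rw [hr, inner_sub_right, inner_sum]
    simp only [inner_smul_right, orthonormal_iff_ite.1 b.orthonormal, mul_ite, mul_one, mul_zero,
      Finset.sum_ite_eq]
    split_ifs <;> simp
  have h1 := (b.hasSum_inner_sq r).mul_left (γ ^ 2)
  have h2 := b.hasSum_inner_sq ((A - B) w)
  -- Parseval: the coefficient of `(A - B) w` along `b p` is `(Λ p - θ) ⟪b p, w⟫`, and off `C` the
  -- first factor is at least `γ` in modulus.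
  have h3 : γ ^ 2 * ‖r‖ ^ 2 ≤ ‖(A - B) w‖ ^ 2 := by
    refine hasSum_le (fun p => ?_) h1 h2
    rw [hbr, _root_.sub_apply, inner_sub_right, hA, hB, inner_smul_right, ← sub_mul, mul_pow]
    split_ifs with hp
    · simp only [ne_eq, OfNat.ofNat_ne_zero, not_false_eq_true, zero_pow, mul_zero]
      positivity
    · have := hgap p hp
      rw [← sq_abs (Λ p - θ)]
      gcongr
  rw [← mul_pow] at h3
  exact (le_of_sq_le_sq h3 (norm_nonneg _)).trans ((A - B).le_opNorm w)

end Hilbert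

/-! ### Orthogonal matrices nearest to almost orthogonal ones. -/

section OrthogonalMatrices

/-- `F U` is a nearest point to `U` in the compact set of orthogonal matrices, hence orthogonal for
every `U`. An asymptotically orthogonal sequence is eventually bounded and its limit points are
orthogonal, so its distance to that set tends to zero. -/
theorem exists_orthogonal_retraction (n : Type*) [Fintype n] [DecidableEq n] :
    ∃ F : (n → n → ℝ) → n → n → ℝ,
      (∀ U p q, ∑ r, F U r p * F U r q = if p = q then 1 else 0) ∧
      ∀ U : ℕ → n → n → ℝ,
        (∀ p q, Tendsto (fun m => ∑ r, U m r p * U m r q) atTop (𝓝 (if p = q then 1 else 0))) →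
        Tendsto (fun m => dist (U m) (F (U m))) atTop (𝓝 0) := by
  let S : Set (n → n → ℝ) := {O | ∀ p q, ∑ r, O r p * O r q = if p = q then 1 else 0}
  have hbound : ∀ (O : n → n → ℝ) (R : ℝ), 1 ≤ R → (∀ p, ∑ r, O r p * O r p ≤ R) →
      O ∈ Metric.closedBall (0 : n → n → ℝ) R := by
    intro O R hR h
    rw [mem_closedBall_zero_iff, pi_norm_le_iff_of_nonneg (by linarith)]
    intro r
    rw [pi_norm_le_iff_of_nonneg (by linarith)]
    intro p
    have h1 : O r p * O r p ≤ R :=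
      (Finset.single_le_sum (f := fun r => O r p * O r p) (fun i _ => mul_self_nonneg _)
        (Finset.mem_univ r)).trans (h p)
    rw [Real.norm_eq_abs]
    refine abs_le_of_sq_le_sq (by nlinarith) (by linarith)
  have hclosed : IsClosed S := by
    simp only [S, Set.ofPred_forall]
    refine isClosed_iInter fun p => isClosed_iInter fun q => isClosed_eq ?_ continuous_const
    fun_prop
  have hcompact : IsCompact S := by
    refine (isCompact_closedBall (0 : n → n → ℝ) 1).of_isClosed_subset hclosed fun O hO => ?_
    exact hbound O 1 le_rfl fun p => (hO p p).le.trans (by simp)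
  have hne : S.Nonempty := ⟨fun i j => if i = j then 1 else 0, fun p q => by simp [eq_comm]⟩
  choose F hFS hF using fun U => hcompact.exists_infDist_eq_dist hne U
  refine ⟨F, hFS, fun U hU => ?_⟩
  simp only [← hF]
  by_contra hcon
  rw [Metric.tendsto_nhds] at hcon
  push Not at hcon
  obtain ⟨ε, hε, hfreq⟩ := hcon
  have hev : ∀ᶠ m in atTop, U m ∈ Metric.closedBall (0 : n → n → ℝ) 2 := by
    have : ∀ᶠ m in atTop, ∀ p, ∑ r, U m r p * U m r p ≤ 2 := by
      rw [eventually_all]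
      intro p
      exact (hU p p).eventually_le_const (by simp)
    filter_upwards [this] with m hm using hbound _ _ one_le_two hm
  have hK : IsCompact (Metric.closedBall (0 : n → n → ℝ) 2 ∩ {V | ε ≤ Metric.infDist V S}) :=
    (isCompact_closedBall _ _).inter_right
      (isClosed_le continuous_const (Metric.continuous_infDist_pt S))
  have hfr : ∃ᶠ m in atTop,
      U m ∈ Metric.closedBall (0 : n → n → ℝ) 2 ∩ {V | ε ≤ Metric.infDist V S} := by
    refine (hfreq.and_eventually hev).mono fun m hm => ⟨hm.2, ?_⟩
    simpa [abs_of_nonneg Metric.infDist_nonneg] using hm.1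
  obtain ⟨V, hV, φ, hφ, hlim⟩ := hK.tendsto_subseq' hfr
  have hVS : V ∈ S := fun p q => by
    have h1 : Tendsto (fun m => ∑ r, U (φ m) r p * U (φ m) r q) atTop
        (𝓝 (∑ r, V r p * V r q)) := by
      have hc : Continuous fun W : n → n → ℝ => ∑ r, W r p * W r q := by fun_prop
      exact (hc.tendsto V).comp hlim
    exact tendsto_nhds_unique h1 ((hU p q).comp hφ.tendsto_atTop)
  have : ε ≤ Metric.infDist V S := hV.2
  rw [Metric.infDist_zero_of_mem hVS] at this
  linarith

/-- The retraction is applied to the `C × C` block, so that matrices over one index type serve all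
clusters of eigenvalues. Column orthogonality of a square block implies row orthogonality. -/
theorem exists_orthogonal_retraction_finset {ι : Type*} [DecidableEq ι] (C : Finset ι) :
    ∃ F : (ι → ι → ℝ) → ι → ι → ℝ,
      (∀ U, ∀ p ∈ C, ∀ q ∈ C, ∑ r ∈ C, F U r p * F U r q = if p = q then 1 else 0) ∧
      (∀ U, ∀ p ∈ C, ∀ q ∈ C, ∑ r ∈ C, F U p r * F U q r = if p = q then 1 else 0) ∧
      ∀ U : ℕ → ι → ι → ℝ,
        (∀ p ∈ C, ∀ q ∈ C, Tendsto (fun m => ∑ r ∈ C, U m r p * U m r q) atTop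
          (𝓝 (if p = q then 1 else 0))) →
        ∀ p ∈ C, ∀ q ∈ C, Tendsto (fun m => U m p q - F (U m) p q) atTop (𝓝 0) := by
  obtain ⟨F, hcol, hlim⟩ := exists_orthogonal_retraction C
  have hrow : ∀ U p q, ∑ r, F U p r * F U q r = if p = q then 1 else 0 := fun U p q => by
    have h : (Matrix.of (F U))ᵀ * Matrix.of (F U) = 1 := by
      ext i j
      simpa [Matrix.mul_apply, Matrix.one_apply] using hcol U i j
    rw [mul_eq_one_comm] at h
    simpa [Matrix.mul_apply, Matrix.one_apply] using congrFun (congrFun h p) q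
  let G : (ι → ι → ℝ) → ι → ι → ℝ := fun U p q =>
    if h : p ∈ C ∧ q ∈ C then F (fun i j => U i j) ⟨p, h.1⟩ ⟨q, h.2⟩ else 0
  have hG : ∀ U (p q : C), G U p q = F (fun i j => U i j) p q := fun U p q => by
    simp [G, p.2, q.2]
  refine ⟨G, fun U p hp q hq => ?_, fun U p hp q hq => ?_, fun U hU p hp q hq => ?_⟩
  · rw [← Finset.sum_coe_sort]
    lift p to C using hp
    lift q to C using hq
    simpa [hG] using hcol (fun i j => U i j) p q
  · rw [← Finset.sum_coe_sort]
    lift p to C using hp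
    lift q to C using hq
    simpa [hG] using hrow (fun i j => U i j) p q
  · lift p to C using hp
    lift q to C using hq
    simp only [hG]
    have h := hlim (fun m i j => U m i j) fun i j => by
      have := hU i i.2 j j.2
      simp only [← Finset.sum_coe_sort C, Subtype.coe_inj] at this
      exact this
    refine squeeze_zero_norm (fun m => ?_) h
    rw [← dist_eq_norm]
    exact (dist_le_pi_dist (fun j : C => U m p j) _ q).trans
      (dist_le_pi_dist (fun i j : C => U m i j) _ p)

end OrthogonalMatrices

/-! ### Perturbation of eigenvectors under norm convergence. -/

section Perturbation

variable {ι H : Type*} [NormedAddCommGroup H] [InnerProductSpace ℝ H]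

/-- If `B m → A` in norm and `w m q` are orthonormal eigenvectors of `B m` whose eigenvalues
converge to those of `A`, then the eigenbasis of `A` can be rotated inside the eigenspaces to
become close to the `w m q`. -/
theorem exists_rotation_of_tendsto [DecidableEq ι] (b : HilbertBasis ι ℝ H) {Λ : ι → ℝ}
    {A : H →L[ℝ] H} (hA : ∀ p x, ⟪b p, A x⟫_ℝ = Λ p * ⟪b p, x⟫_ℝ) (C : ι → Finset ι)
    (hC : ∀ p q, p ∈ C q ↔ Λ p = Λ q)
    (hgap : ∀ q, ∃ γ > 0, ∀ p, p ∉ C q → γ ≤ |Λ p - Λ q|) (w : ℕ → ι → H) :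
    ∃ O : ℕ → ι → ι → ℝ,
      (∀ m s, ∀ p ∈ C s, ∀ q ∈ C s, ∑ r ∈ C s, O m r p * O m r q = if p = q then 1 else 0) ∧
      (∀ m s, ∀ p ∈ C s, ∀ q ∈ C s, ∑ r ∈ C s, O m p r * O m q r = if p = q then 1 else 0) ∧
      ∀ (B : ℕ → H →L[ℝ] H) (θ : ℕ → ι → ℝ), Tendsto (fun m => ‖A - B m‖) atTop (𝓝 0) →
        (∀ q, ∀ᶠ m in atTop, B m (w m q) = θ m q • w m q) →
        (∀ p q, ∀ᶠ m in atTop, ⟪w m p, w m q⟫_ℝ = if p = q then 1 else 0) →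
        (∀ q, Tendsto (fun m => θ m q) atTop (𝓝 (Λ q))) →
        ∀ q, Tendsto (fun m => ‖∑ p ∈ C q, O m p q • b p - w m q‖) atTop (𝓝 0) := by
  have hself : ∀ q, q ∈ C q := fun q => (hC q q).2 rfl
  have hCeq : ∀ {p q}, p ∈ C q → C p = C q := fun {p q} h => by
    ext r
    rw [hC, hC, (hC p q).1 h]
  choose F hcol hrow hlim using fun C : Finset ι => exists_orthogonal_retraction_finset C
  let U : ℕ → ι → ι → ℝ := fun m p q => ⟪b p, w m q⟫_ℝ
  -- Column `q` comes from the overlap matrix restricted to the cluster of `q`; clusters are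
  -- equivalence classes, so all columns of a cluster use the same block. Orthogonality thus holds
  -- for every `m`, not only for large `m`.
  refine ⟨fun m p q => F (C q) (U m) p q, fun m s p hp q hq => ?_, fun m s p hp q hq => ?_,
    fun B θ hB hw horth hθ => ?_⟩
  · beta_reduce
    rw [hCeq hp, hCeq hq]
    exact hcol _ _ p hp q hq
  · rw [← hrow (C s) (U m) p hp q hq]
    refine Finset.sum_congr rfl fun r hr => ?_
    beta_reduce
    rw [hCeq hr]
  have htail : ∀ q, Tendsto (fun m => ‖w m q - ∑ p ∈ C q, U m p q • b p‖) atTop (𝓝 0) := by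
    intro q
    obtain ⟨γ, hγ, hg⟩ := hgap q
    have hsmall : ∀ᶠ m in atTop, |θ m q - Λ q| < γ / 2 := by
      have := (Metric.tendsto_nhds.1 (hθ q)) (γ / 2) (by positivity)
      simpa [Real.dist_eq] using this
    have hlim0 : Tendsto (fun m => (γ / 2)⁻¹ * ‖A - B m‖) atTop (𝓝 0) := by
      simpa using hB.const_mul (γ / 2)⁻¹
    refine squeeze_zero' (Eventually.of_forall fun _ => norm_nonneg _) ?_ hlim0
    filter_upwards [hsmall, hw q, horth q q] with m hm hwm hom
    have hn : ‖w m q‖ = 1 := by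
      rw [if_pos rfl, real_inner_self_eq_norm_sq] at hom
      nlinarith [norm_nonneg (w m q)]
    -- Once `θ m q` is within `γ / 2` of `Λ q`, half of the gap `γ` remains.
    have := norm_sub_sum_le_of_spectral_gap b hA hwm (C := C q) (γ := γ / 2) (by positivity)
      fun p hp => by
        have h1 := hg p hp
        have h2 := abs_sub_le (Λ p) (θ m q) (Λ q)
        linarith
    rw [hn, mul_one] at this
    rw [inv_mul_eq_div, le_div_iff₀ (by positivity), mul_comm]
    exact this
  -- The `w m q` are eventually orthonormal and their components outside the cluster vanish in the
  -- limit, so the overlap block is asymptotically orthogonal.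
  have hgram : ∀ s, ∀ p ∈ C s, ∀ q ∈ C s,
      Tendsto (fun m => ∑ r ∈ C s, U m r p * U m r q) atTop (𝓝 (if p = q then 1 else 0)) := by
    intro s p hp q hq
    have hdiff : Tendsto (fun m => ⟪w m p, w m q - ∑ r ∈ C s, U m r q • b r⟫_ℝ) atTop (𝓝 0) := by
      refine squeeze_zero_norm' ?_ ((hCeq hq) ▸ htail q)
      filter_upwards [horth p p] with m hom
      have hn : ‖w m p‖ = 1 := by
        rw [if_pos rfl, real_inner_self_eq_norm_sq] at hom
        nlinarith [norm_nonneg (w m p)]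
      refine (norm_inner_le_norm _ _).trans ?_
      rw [hn, one_mul]
    have h2 : Tendsto (fun m => (if p = q then (1 : ℝ) else 0) -
        ⟪w m p, w m q - ∑ r ∈ C s, U m r q • b r⟫_ℝ) atTop (𝓝 ((if p = q then 1 else 0) - 0)) :=
      tendsto_const_nhds.sub hdiff
    rw [sub_zero] at h2
    refine h2.congr' ?_
    filter_upwards [horth p q] with m hom
    rw [inner_sub_right, hom, sub_sub_cancel, inner_sum]
    refine Finset.sum_congr rfl fun r _ => ?_
    rw [inner_smul_right, real_inner_comm, mul_comm]
  intro q
  have hF : Tendsto (fun m => ∑ p ∈ C q, ‖U m p q - F (C q) (U m) p q‖) atTop (𝓝 0) := by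
    have := tendsto_finsetSum (C q) fun p hp =>
      (hlim (C q) U (hgram q) p hp q (hself q)).norm
    simpa using this
  refine squeeze_zero (fun _ => norm_nonneg _) (fun m => ?_) (by simpa using hF.add (htail q))
  have : ∑ p ∈ C q, F (C q) (U m) p q • b p - w m q =
      -(∑ p ∈ C q, (U m p q - F (C q) (U m) p q) • b p) -
        (w m q - ∑ p ∈ C q, U m p q • b p) := by
    simp only [sub_smul, Finset.sum_sub_distrib]
    abel
  rw [this]
  refine (norm_sub_le _ _).trans (add_le_add_left ?_ _)
  rw [norm_neg]
  refine (norm_sum_le _ _).trans (Finset.sum_le_sum fun p _ => ?_)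
  rw [norm_smul, b.orthonormal.1, mul_one, Real.norm_eq_abs]

end Perturbation

/-! ### Continuous functions on compact spaces and vector-valued equidistribution. -/

theorem Continuous.integrable_of_compactSpace {X F : Type*} [TopologicalSpace X] [CompactSpace X]
    [MeasurableSpace X] [OpensMeasurableSpace X] [NormedAddCommGroup F]
    [SecondCountableTopologyEither X F] {ν : Measure X} [IsFiniteMeasure ν] {G : X → F}
    (hG : Continuous G) : Integrable G ν :=
  integrableOn_univ.1 (hG.continuousOn.integrableOn_compact' isCompact_univ MeasurableSet.univ)

section Equidistribution

variable {X : Type*} [TopologicalSpace X] [CompactSpace X] {F : Type*} [NormedAddCommGroup F]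
  [NormedSpace ℝ F]

/-- Continuous functions into a normed space are uniform limits of finite sums of continuous scalar
functions times constant vectors. -/
theorem Continuous.exists_norm_sub_sum_smul_le {G : X → F} (hG : Continuous G) {ε : ℝ}
    (hε : 0 < ε) :
    ∃ (t : Finset X) (c : X → X → ℝ), (∀ i, Continuous (c i)) ∧
      ∀ x, ‖G x - ∑ i ∈ t, c i x • G i‖ ≤ ε := by
  obtain ⟨t, -, ht⟩ := isCompact_univ.elim_nhds_subcover
    (fun x => {y | ‖G y - G x‖ < ε}) fun x _ => by
      have : ContinuousAt (fun y => ‖G y - G x‖) x := by fun_prop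
      exact this.eventually_lt_const (by simpa using hε)
  -- Normalizing these bumps gives a partition of unity; bump `i` vanishes wherever `G` is at
  -- distance at least `ε` from `G i`.
  let ψ : X → X → ℝ := fun i x => max 0 (ε - ‖G x - G i‖)
  have hψc : ∀ i, Continuous (ψ i) := fun i => by fun_prop
  have hψ0 : ∀ i x, 0 ≤ ψ i x := fun i x => le_max_left _ _
  have hpos : ∀ x, 0 < ∑ i ∈ t, ψ i x := fun x => by
    obtain ⟨i, hi, hx⟩ := Set.mem_iUnion₂.1 (ht (Set.mem_univ x))
    exact Finset.sum_pos' (fun i _ => hψ0 i x) ⟨i, hi, lt_max_of_lt_right (sub_pos.2 hx)⟩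
  refine ⟨t, fun i x => ψ i x / ∑ j ∈ t, ψ j x, fun i => ?_, fun x => ?_⟩
  · exact (hψc i).div (continuous_finsetSum _ fun j _ => hψc j) fun x => (hpos x).ne'
  have hsum : ∑ i ∈ t, ψ i x / ∑ j ∈ t, ψ j x = 1 := by
    rw [← Finset.sum_div, div_self (hpos x).ne']
  have : G x - ∑ i ∈ t, (ψ i x / ∑ j ∈ t, ψ j x) • G i =
      ∑ i ∈ t, (ψ i x / ∑ j ∈ t, ψ j x) • (G x - G i) := by
    simp only [smul_sub, Finset.sum_sub_distrib]
    rw [← Finset.sum_smul, hsum, one_smul]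
  rw [this]
  calc _ ≤ ∑ i ∈ t, (ψ i x / ∑ j ∈ t, ψ j x) * ε := by
        refine (norm_sum_le _ _).trans (Finset.sum_le_sum fun i _ => ?_)
        rw [norm_smul, Real.norm_of_nonneg (div_nonneg (hψ0 i x) (hpos x).le)]
        rcases le_or_gt ‖G x - G i‖ ε with h | h
        · gcongr
        · have : ψ i x = 0 := max_eq_left (by linarith)
          simp [this]
    _ = ε := by rw [← Finset.sum_mul, hsum, one_mul]

variable [MeasurableSpace X] [OpensMeasurableSpace X] {ν : Measure X} [IsFiniteMeasure ν]

/-- Equidistribution for scalar functions implies equidistribution for vector-valued functions. -/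
theorem IsEquidistributed.tendsto_average [CompleteSpace F] [SecondCountableTopology X] {N : ℕ → ℕ}
    {a : ∀ m, Fin (N m) → X} (ha : IsEquidistributed ν a) {G : X → F} (hG : Continuous G) :
    Tendsto (fun m => (N m : ℝ)⁻¹ • ∑ l, G (a m l)) atTop
      (𝓝 ((ν.real Set.univ)⁻¹ • ∫ x, G x ∂ν)) := by
  rw [Metric.tendsto_nhds]
  intro ε hε
  obtain ⟨t, c, hc, happ⟩ := hG.exists_norm_sub_sum_smul_le (show 0 < ε / 3 by positivity)
  let S : X → F := fun x => ∑ i ∈ t, c i x • G i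
  have hSc : Continuous S := continuous_finsetSum _ fun i _ => (hc i).smul continuous_const
  have hS : Tendsto (fun m => (N m : ℝ)⁻¹ • ∑ l, S (a m l)) atTop
      (𝓝 ((ν.real Set.univ)⁻¹ • ∫ x, S x ∂ν)) := by
    have h1 : ∫ x, S x ∂ν = ∑ i ∈ t, (∫ x, c i x ∂ν) • G i := by
      have hi : ∀ i ∈ t, Integrable (fun x => c i x • G i) ν := fun i _ =>
        ((hc i).smul continuous_const).integrable_of_compactSpace
      rw [integral_finsetSum _ hi]
      exact Finset.sum_congr rfl fun i _ => integral_smul_const _ _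
    have h2 : ∀ m, (N m : ℝ)⁻¹ • ∑ l, S (a m l) =
        ∑ i ∈ t, ((N m : ℝ)⁻¹ * ∑ l, c i (a m l)) • G i := fun m => by
      simp only [S]
      rw [Finset.sum_comm, Finset.smul_sum]
      refine Finset.sum_congr rfl fun i _ => ?_
      rw [← Finset.sum_smul, smul_smul]
    rw [h1, Finset.smul_sum]
    simp only [h2, smul_smul]
    exact tendsto_finsetSum _ fun i _ => (ha _ (hc i)).smul_const _
  have hgrid : ∀ m, ‖(N m : ℝ)⁻¹ • ∑ l, G (a m l) - (N m : ℝ)⁻¹ • ∑ l, S (a m l)‖ ≤ ε / 3 := by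
    intro m
    rw [← smul_sub, ← Finset.sum_sub_distrib, norm_smul, norm_inv, Real.norm_natCast]
    have : ‖∑ l, (G (a m l) - S (a m l))‖ ≤ N m * (ε / 3) := by
      refine (norm_sum_le _ _).trans ((Finset.sum_le_sum fun l _ => happ (a m l)).trans ?_)
      simp
    -- For an empty grid `(N m)⁻¹ = 0` and the bound is trivial.
    rcases (Nat.cast_nonneg (α := ℝ) (N m)).eq_or_lt with h0 | h0
    · rw [← h0]
      simp only [inv_zero, zero_mul]
      positivity
    · rw [inv_mul_le_iff₀ h0]
      exact this
  have hint : ‖(ν.real Set.univ)⁻¹ • ∫ x, S x ∂ν - (ν.real Set.univ)⁻¹ • ∫ x, G x ∂ν‖ ≤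
      ε / 3 := by
    rw [← smul_sub, ← integral_sub hSc.integrable_of_compactSpace hG.integrable_of_compactSpace,
      norm_smul, norm_inv, Real.norm_of_nonneg measureReal_nonneg]
    have : ‖∫ x, (S x - G x) ∂ν‖ ≤ ε / 3 * ν.real Set.univ :=
      norm_integral_le_of_norm_le_const (Eventually.of_forall fun x => by
        rw [norm_sub_rev]; exact happ x)
    rcases (measureReal_nonneg (μ := ν) (s := Set.univ)).eq_or_lt with h0 | h0
    · rw [← h0]
      simp only [inv_zero, zero_mul]
      positivity
    · rw [inv_mul_le_iff₀ h0, mul_comm]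
      exact this
  filter_upwards [(Metric.tendsto_nhds.1 hS) (ε / 3) (by positivity)] with m hm
  rw [dist_eq_norm] at hm ⊢
  have := norm_sub_le_norm_sub_add_norm_sub ((N m : ℝ)⁻¹ • ∑ l, G (a m l))
    ((N m : ℝ)⁻¹ • ∑ l, S (a m l)) ((ν.real Set.univ)⁻¹ • ∫ x, G x ∂ν)
  have := norm_sub_le_norm_sub_add_norm_sub ((N m : ℝ)⁻¹ • ∑ l, S (a m l))
    ((ν.real Set.univ)⁻¹ • ∫ x, S x ∂ν) ((ν.real Set.univ)⁻¹ • ∫ x, G x ∂ν)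
  linarith [hgrid m]

end Equidistribution

/-! ### Diagonalization, rank and quadratic form of a matrix with an eigensystem. -/

section Eigensystem

variable {N : ℕ} {A : Matrix (Fin N) (Fin N) ℝ} {ℓ : Fin N → ℝ} {v : Fin N → Fin N → ℝ}

namespace IsEigensystem

theorem of_mul_transpose (h : IsEigensystem A ℓ v) : Matrix.of v * (Matrix.of v)ᵀ = 1 := by
  ext p q
  have := h.orthonormal p q
  simpa [Matrix.mul_apply, dotProduct, Matrix.one_apply] using this

theorem transpose_mul_of (h : IsEigensystem A ℓ v) : (Matrix.of v)ᵀ * Matrix.of v = 1 :=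
  mul_eq_one_comm.1 h.of_mul_transpose

theorem eq_mul_diagonal_mul (h : IsEigensystem A ℓ v) :
    A = (Matrix.of v)ᵀ * Matrix.diagonal ℓ * Matrix.of v := by
  have h1 : A * (Matrix.of v)ᵀ = (Matrix.of v)ᵀ * Matrix.diagonal ℓ := by
    ext i q
    have := congrFun (h.eigen q) i
    rw [Matrix.mul_diagonal]
    simpa [Matrix.mul_apply, Matrix.mulVec, dotProduct, mul_comm] using this
  rw [← h1, Matrix.mul_assoc, h.transpose_mul_of, Matrix.mul_one]

theorem rank_eq (h : IsEigensystem A ℓ v) : A.rank = Fintype.card {p // ℓ p ≠ 0} := by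
  have hdet : IsUnit (Matrix.of v).det := by
    rw [← Matrix.isUnit_iff_isUnit_det]
    exact IsUnit.of_mul_eq_one _ h.of_mul_transpose
  rw [h.eq_mul_diagonal_mul, Matrix.rank_mul_eq_left_of_isUnit_det _ _ hdet,
    Matrix.rank_mul_eq_right_of_isUnit_det _ _ (by rwa [Matrix.det_transpose]),
    Matrix.rank_diagonal]

/-- The rank counts the nonzero eigenvalues; being nonnegative and sorted, these occupy an initial
segment of the (zero-based) indices. -/
theorem lt_rank_iff (h : IsEigensystem A ℓ v) (hℓ : ∀ p, 0 ≤ ℓ p) (q : Fin N) :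
    (q : ℕ) < A.rank ↔ 0 < ℓ q := by
  rw [h.rank_eq, Fintype.card_subtype]
  constructor
  · intro hlt
    refine (hℓ q).lt_of_ne fun h0 => hlt.not_ge ?_
    rw [← Fin.card_Iio]
    refine Finset.card_le_card fun p hp => ?_
    rw [Finset.mem_Iio]
    by_contra hqp
    have := h.antitone (not_lt.1 hqp)
    exact (Finset.mem_filter.1 hp).2 (le_antisymm (by rwa [← h0] at this) (hℓ p))
  · intro hpos
    rw [Nat.lt_iff_add_one_le, ← Fin.card_Iic]
    refine Finset.card_le_card fun p hp => ?_
    simp only [Finset.mem_filter, Finset.mem_univ, true_and]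
    exact (hpos.trans_le (h.antitone (Finset.mem_Iic.1 hp))).ne'

theorem sum_dotProduct_sq (h : IsEigensystem A ℓ v) (y : Fin N → ℝ) :
    ∑ p, (v p ⬝ᵥ y) ^ 2 = y ⬝ᵥ y := by
  have h1 : ∑ p, (v p ⬝ᵥ y) ^ 2 = (Matrix.of v *ᵥ y) ⬝ᵥ (Matrix.of v *ᵥ y) := by
    simp [dotProduct, Matrix.mulVec, sq]
  rw [h1, Matrix.dotProduct_mulVec, Matrix.vecMul_mulVec, h.transpose_mul_of, Matrix.vecMul_one]

theorem dotProduct_mulVec_eq (h : IsEigensystem A ℓ v) (y : Fin N → ℝ) :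
    y ⬝ᵥ A *ᵥ y = ∑ p, ℓ p * (v p ⬝ᵥ y) ^ 2 := by
  have h1 : ∑ p, ℓ p * (v p ⬝ᵥ y) ^ 2 =
      (Matrix.of v *ᵥ y) ⬝ᵥ (Matrix.diagonal ℓ *ᵥ (Matrix.of v *ᵥ y)) := by
    refine Finset.sum_congr rfl fun p _ => ?_
    rw [Matrix.mulVec_diagonal]
    change _ = (v p ⬝ᵥ y) * (ℓ p * (v p ⬝ᵥ y))
    ring
  conv_lhs => rw [h.eq_mul_diagonal_mul]
  rw [h1, Matrix.dotProduct_mulVec _ (Matrix.diagonal ℓ), Matrix.dotProduct_mulVec,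
    Matrix.dotProduct_mulVec, ← Matrix.vecMul_transpose, Matrix.vecMul_vecMul,
    Matrix.vecMul_vecMul, Matrix.mul_assoc]

end IsEigensystem

end Eigensystem

/-! ### Feature maps, and the duality between integral and covariance operators. -/

noncomputable section

theorem exists_norm_le_of_continuous {X F : Type*} [TopologicalSpace X] [CompactSpace X]
    [SeminormedAddCommGroup F] {f : X → F} (hf : Continuous f) : ∃ M : ℝ, ∀ x, ‖f x‖ ≤ M := by
  obtain ⟨M, hM⟩ := isCompact_univ.exists_bound_of_continuousOn hf.continuousOn
  exact ⟨M, fun x => hM x (Set.mem_univ x)⟩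

theorem continuous_rankOne_self {X H : Type*} [TopologicalSpace X] [NormedAddCommGroup H]
    [InnerProductSpace ℝ H] {φ : X → H} (hφ : Continuous φ) :
    Continuous fun y => InnerProductSpace.rankOne ℝ (φ y) (φ y) :=
  ((InnerProductSpace.rankOne ℝ).continuous.comp hφ).clm_apply hφ

section FeatureMap

variable {X H : Type*} [MeasurableSpace X] [NormedAddCommGroup H] [InnerProductSpace ℝ H]

/-- The synthesis operator `f ↦ ∫ f(y) φ(y) dν(y)` of a feature map. -/
def synthesis (ν : Measure X) (φ : X → H) (f : X → ℝ) : H :=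
  ∫ y, f y • φ y ∂ν

/-- The covariance operator `∫ φ(y) ⊗ φ(y) dν(y)` of a feature map. -/
def covariance (ν : Measure X) (φ : X → H) : H →L[ℝ] H :=
  ∫ y, InnerProductSpace.rankOne ℝ (φ y) (φ y) ∂ν

theorem synthesis_const_mul (ν : Measure X) (φ : X → H) (c : ℝ) (f : X → ℝ) :
    synthesis ν φ (fun y => c * f y) = c • synthesis ν φ f := by
  simp only [synthesis, mul_smul]
  exact integral_smul c _

variable [TopologicalSpace X] [CompactSpace X] [SecondCountableTopology X] [BorelSpace X]
  {ν : Measure X} {φ : X → H}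

theorem integrable_smul_featureMap (hφ : Continuous φ) {f : X → ℝ} (hf : Integrable f ν) :
    Integrable (fun y => f y • φ y) ν := by
  obtain ⟨M, hM⟩ := exists_norm_le_of_continuous hφ
  refine (hf.norm.mul_const M).mono' (hf.1.smul hφ.aestronglyMeasurable)
    (Eventually.of_forall fun x => ?_)
  rw [norm_smul]
  gcongr
  exact hM x

/-- This is `T = S S*`. -/
theorem covariance_apply [IsFiniteMeasure ν] (hφ : Continuous φ) (h : H) :
    covariance ν φ h = synthesis ν φ fun y => ⟪φ y, h⟫_ℝ := by
  have hc := continuous_rankOne_self hφ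
  rw [covariance, ContinuousLinearMap.integral_apply hc.integrable_of_compactSpace, synthesis]
  rfl

variable [CompleteSpace H]

theorem inner_synthesis (hφ : Continuous φ) {f : X → ℝ} (hf : Integrable f ν) (h : H) :
    ⟪h, synthesis ν φ f⟫_ℝ = ∫ y, f y * ⟪φ y, h⟫_ℝ ∂ν := by
  rw [synthesis, ← integral_inner (integrable_smul_featureMap hφ hf)]
  simp only [inner_smul_right, real_inner_comm]

/-- This is `𝒦 = S* S`, valid at every point and not only almost everywhere. -/
theorem integralOperator_eq_inner_synthesis (hφ : Continuous φ) {k : X → X → ℝ}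
    (hk : ∀ x y, k x y = ⟪φ x, φ y⟫_ℝ) {f : X → ℝ} (hf : Integrable f ν) (x : X) :
    integralOperator ν k f x = ⟪φ x, synthesis ν φ f⟫_ℝ := by
  rw [inner_synthesis hφ hf, integralOperator]
  simp only [hk, real_inner_comm, mul_comm]

variable [IsFiniteMeasure ν]

theorem inner_covariance (hφ : Continuous φ) (g h : H) :
    ⟪g, covariance ν φ h⟫_ℝ = ∫ y, ⟪φ y, h⟫_ℝ * ⟪φ y, g⟫_ℝ ∂ν := by
  have hc : Continuous fun y => ⟪φ y, h⟫_ℝ := by fun_prop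
  rw [covariance_apply hφ, inner_synthesis hφ hc.integrable_of_compactSpace]

theorem inner_covariance_comm (hφ : Continuous φ) (g h : H) :
    ⟪g, covariance ν φ h⟫_ℝ = ⟪covariance ν φ g, h⟫_ℝ := by
  rw [inner_covariance hφ, real_inner_comm, inner_covariance hφ]
  simp only [mul_comm]

variable {k : X → X → ℝ} {ev : ℕ → ℝ} {e : ℕ → X → ℝ}

theorem IsSpectralDecomposition.inner_synthesis_synthesis (hφ : Continuous φ)
    (hk : ∀ x y, k x y = ⟪φ x, φ y⟫_ℝ) (hspec : IsSpectralDecomposition ν k ev e)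
    {p q : ℕ} (hp : ev p ≠ 0) (hq : ev q ≠ 0) :
    ⟪synthesis ν φ (e p), synthesis ν φ (e q)⟫_ℝ = if p = q then ev p else 0 := by
  have hi : ∀ {q}, ev q ≠ 0 → Integrable (e q) ν := fun hq =>
    (hspec.memLp _ hq).integrable one_le_two
  have h1 : ∀ y, ⟪φ y, synthesis ν φ (e p)⟫_ℝ = ev p * e p y := fun y => by
    rw [← integralOperator_eq_inner_synthesis hφ hk (hi hp), hspec.eigen p hp]
  rw [inner_synthesis hφ (hi hq)]
  simp only [h1]
  calc ∫ y, e q y * (ev p * e p y) ∂ν = ev p * ∫ y, e p y * e q y ∂ν := by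
        rw [← integral_const_mul]
        congr 1
        ext y
        ring
    _ = _ := by
        rw [hspec.orthonormal p q hp hq]
        split_ifs <;> simp

/-- A nonzero eigenvalue equals `‖S e_q‖²`. -/
theorem IsSpectralDecomposition.eigenvalue_nonneg (hφ : Continuous φ)
    (hk : ∀ x y, k x y = ⟪φ x, φ y⟫_ℝ) (hspec : IsSpectralDecomposition ν k ev e) (q : ℕ) :
    0 ≤ ev q := by
  by_cases hq : ev q = 0
  · exact hq.ge
  · have := hspec.inner_synthesis_synthesis hφ hk hq hq
    rw [if_pos rfl] at this
    rw [← this]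
    exact real_inner_self_nonneg

/-- The functions `√(ev q) • e q` form a Hilbert basis. -/
theorem IsSpectralDecomposition.exists_hilbertBasis [ν.IsOpenPosMeasure] (hφ : Continuous φ)
    (hk : ∀ x y, k x y = ⟪φ x, φ y⟫_ℝ) (htot : ∀ h : H, (∀ x, ⟪φ x, h⟫_ℝ = 0) → h = 0)
    (hspec : IsSpectralDecomposition ν k ev e) :
    ∃ b : HilbertBasis (NonzeroIndex ev) ℝ H,
      (∀ q x, ⟪φ x, b q⟫_ℝ = √(ev q) * e q x) ∧
      ∀ q, covariance ν φ (b q) = ev q • b q := by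
  classical
  have hpos : ∀ q : NonzeroIndex ev, 0 < ev q := fun q =>
    (hspec.eigenvalue_nonneg hφ hk q).lt_of_ne q.2.symm
  have hi : ∀ q : NonzeroIndex ev, Integrable (e q) ν := fun q =>
    (hspec.memLp _ q.2).integrable one_le_two
  let u : NonzeroIndex ev → H := fun q => (√(ev q))⁻¹ • synthesis ν φ (e q)
  have hu : Orthonormal ℝ u := by
    rw [orthonormal_iff_ite]
    intro p q
    simp only [u, inner_smul_left, inner_smul_right, conj_trivial,
      hspec.inner_synthesis_synthesis hφ hk p.2 q.2, Subtype.coe_inj]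
    split_ifs with h
    · subst h
      have h1 := Real.sq_sqrt (hpos p).le
      have h2 := (Real.sqrt_pos.2 (hpos p)).ne'
      field_simp
      exact h1.symm
    · simp
  have hux : ∀ q x, ⟪φ x, u q⟫_ℝ = √(ev q) * e q x := fun q x => by
    have h1 := Real.sq_sqrt (hpos q).le
    have h2 := (Real.sqrt_pos.2 (hpos q)).ne'
    rw [inner_smul_right, ← integralOperator_eq_inner_synthesis hφ hk (hi q), hspec.eigen q q.2]
    field_simp
    rw [h1]
  have hcov : ∀ q, covariance ν φ (u q) = ev q • u q := fun q => by
    rw [covariance_apply hφ]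
    simp only [hux, synthesis_const_mul, u, smul_smul]
    congr 1
    have h1 := Real.sq_sqrt (hpos q).le
    have h2 := (Real.sqrt_pos.2 (hpos q)).ne'
    field_simp
    exact h1
  have hcomplete : (Submodule.span ℝ (Set.range u))ᗮ = ⊥ := by
    rw [Submodule.eq_bot_iff]
    intro h hh
    rw [Submodule.mem_orthogonal] at hh
    have hperp : ∀ q, ⟪u q, h⟫_ℝ = 0 := fun q => hh _ (Submodule.subset_span ⟨q, rfl⟩)
    let f : X → ℝ := fun y => ⟪φ y, h⟫_ℝ
    have hf : Continuous f := by fun_prop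
    have hfi : Integrable f ν := hf.integrable_of_compactSpace
    have hcoef : ∀ q, ev q ≠ 0 → ∫ y, e q y * f y ∂ν = 0 := fun q hq => by
      rw [← inner_synthesis hφ (hi ⟨q, hq⟩), real_inner_comm]
      have := hperp ⟨q, hq⟩
      simp only [u, inner_smul_left, conj_trivial, mul_eq_zero, inv_eq_zero] at this
      exact this.resolve_left (Real.sqrt_pos.2 (hpos ⟨q, hq⟩)).ne'
    have hKc : Continuous fun x => ⟪φ x, synthesis ν φ f⟫_ℝ := by fun_prop
    -- All coefficients of `f` vanish, so the remainders in the decomposition all equal `𝒦 f`; their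
    -- `L²` norms tend to zero, hence `𝒦 f = 0` almost everywhere.
    have hK : ∀ᵐ x ∂ν, ⟪φ x, synthesis ν φ f⟫_ℝ = 0 := by
      obtain ⟨M, hM⟩ := exists_norm_le_of_continuous hf
      have h2 : MemLp f 2 ν := MemLp.of_bound hf.aestronglyMeasurable M (Eventually.of_forall hM)
      have hdec := hspec.decomposition f h2
      have hz : ∀ Q : ℕ, (fun x => integralOperator ν k f x -
          ∑ q ∈ Finset.range Q, ev q * (∫ y, e q y * f y ∂ν) * e q x) =
          fun x => ⟪φ x, synthesis ν φ f⟫_ℝ := fun Q => by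
        ext x
        rw [integralOperator_eq_inner_synthesis hφ hk hfi, Finset.sum_eq_zero, sub_zero]
        intro q _
        by_cases hq : ev q = 0
        · simp [hq]
        · simp [hcoef q hq]
      simp only [hz] at hdec
      have h0 := tendsto_nhds_unique tendsto_const_nhds hdec
      rw [eLpNorm_eq_zero_iff hKc.aestronglyMeasurable two_ne_zero] at h0
      exact h0
    -- `‖S f‖² = ∫ f · 𝒦 f`.
    have hsynth : synthesis ν φ f = 0 := by
      rw [← inner_self_eq_zero (𝕜 := ℝ), inner_synthesis hφ hfi]
      refine integral_eq_zero_of_ae ?_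
      filter_upwards [hK] with x hx
      simp [hx]
    have hsq : ∫ y, f y * f y ∂ν = 0 := by
      have := inner_synthesis hφ hfi h
      rw [hsynth, inner_zero_right] at this
      exact this.symm
    have hff : Continuous fun y => f y * f y := by fun_prop
    -- Full support of the measure upgrades almost everywhere vanishing of a continuous function to
    -- vanishing.
    have h0 : (fun y => f y * f y) = 0 := by
      rw [integral_eq_zero_iff_of_nonneg (fun y => mul_self_nonneg _)
        hff.integrable_of_compactSpace] at hsq
      exact (hff.ae_eq_iff_eq ν continuous_zero).1 hsq
    exact htot h fun x => mul_self_eq_zero.1 (congrFun h0 x)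
  refine ⟨HilbertBasis.mkOfOrthogonalEqBot hu hcomplete, ?_, ?_⟩ <;>
    simpa only [HilbertBasis.coe_mkOfOrthogonalEqBot]

/-- Conversely, a Hilbert basis of eigenvectors of the covariance operator yields a spectral
decomposition of the integral operator. -/
theorem isSpectralDecomposition_of_hilbertBasis (hφ : Continuous φ)
    (hk : ∀ x y, k x y = ⟪φ x, φ y⟫_ℝ) (hanti : Antitone ev) (hnonneg : ∀ q, 0 ≤ ev q)
    (b : HilbertBasis (NonzeroIndex ev) ℝ H) (hb : ∀ q x, ⟪φ x, b q⟫_ℝ = √(ev q) * e q x)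
    (hcov : ∀ q, covariance ν φ (b q) = ev q • b q) :
    IsSpectralDecomposition ν k ev e := by
  classical
  have hpos : ∀ q : NonzeroIndex ev, 0 < ev q := fun q => (hnonneg q).lt_of_ne q.2.symm
  have hsqrt : ∀ q : NonzeroIndex ev, √(ev q) ≠ 0 := fun q => (Real.sqrt_pos.2 (hpos q)).ne'
  have he : ∀ q : NonzeroIndex ev, e q = fun x => (√(ev q))⁻¹ * ⟪φ x, b q⟫_ℝ := fun q => by
    ext x
    rw [hb, inv_mul_cancel_left₀ (hsqrt q)]
  have hec : ∀ q : NonzeroIndex ev, Continuous (e q) := fun q => by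
    rw [he]
    fun_prop
  refine ⟨hanti, fun q hq => ?_, fun q hq x => ?_, fun p q hp hq => ?_, fun f hf => ?_⟩
  · obtain ⟨M, hM⟩ := exists_norm_le_of_continuous (hec ⟨q, hq⟩)
    exact MemLp.of_bound (hec ⟨q, hq⟩).aestronglyMeasurable M (Eventually.of_forall hM)
  · lift q to NonzeroIndex ev using hq
    rw [integralOperator_eq_inner_synthesis hφ hk (hec q).integrable_of_compactSpace, he,
      synthesis_const_mul, ← covariance_apply hφ, hcov, inner_smul_right, inner_smul_right]
    ring
  · lift p to NonzeroIndex ev using hp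
    lift q to NonzeroIndex ev using hq
    have h1 : ∫ x, e p x * e q x ∂ν = (√(ev p))⁻¹ * (√(ev q))⁻¹ * ⟪b p, covariance ν φ (b q)⟫_ℝ := by
      rw [inner_covariance hφ, ← integral_const_mul, he p, he q]
      congr 1
      ext x
      ring
    rw [h1, hcov, inner_smul_right, orthonormal_iff_ite.1 b.orthonormal]
    simp only [Subtype.coe_inj]
    split_ifs with h
    · subst h
      have h1 := Real.sq_sqrt (hpos p).le
      have h2 := hsqrt p
      field_simp
      exact h1.symm
    · simp
  · have hfi : Integrable f ν := hf.integrable one_le_two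
    set h := synthesis ν φ f with hh
    -- The expansion of `S f`, extended by zero to all indices so that its partial sums match those
    -- of the decomposition.
    let g : ℕ → H := fun q => if hq : ev q ≠ 0 then ⟪b ⟨q, hq⟩, h⟫_ℝ • b ⟨q, hq⟩ else 0
    have hg : HasSum g h := by
      rw [← Subtype.val_injective.hasSum_iff (g := ((↑) : NonzeroIndex ev → ℕ))]
      · have := b.hasSum_repr h
        simp only [b.repr_apply_apply] at this
        refine this.congr_fun fun q => ?_
        simp [g, q.2]
      · intro q hq
        have : ¬ ev q ≠ 0 := fun h => hq ⟨⟨q, h⟩, rfl⟩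
        simp only [g, dif_neg this]
    have hlim : Tendsto (fun Q => ‖h - ∑ q ∈ Finset.range Q, g q‖) atTop (𝓝 0) := by
      have := (tendsto_const_nhds (x := h)).sub hg.tendsto_sum_nat
      rw [sub_self] at this
      simpa using this.norm
    have hterm : ∀ q x, ev q * (∫ y, e q y * f y ∂ν) * e q x = ⟪φ x, g q⟫_ℝ := fun q x => by
      by_cases hq : ev q ≠ 0
      · lift q to NonzeroIndex ev using hq
        have h1 : ⟪b q, h⟫_ℝ = √(ev q) * ∫ y, e q y * f y ∂ν := by
          rw [hh, inner_synthesis hφ hfi, ← integral_const_mul]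
          congr 1
          ext y
          rw [hb]
          ring
        simp only [g, dif_pos q.2, Subtype.coe_eta, inner_smul_right, h1, hb]
        nth_rewrite 1 [← Real.mul_self_sqrt (hpos q).le]
        ring
      · simp only [g, dif_neg hq, inner_zero_right]
        simp [not_not.1 hq]
    obtain ⟨M, hM⟩ := exists_norm_le_of_continuous hφ
    -- Convergence in `H` is uniform convergence because `‖φ x‖ ≤ M`, and the measure is finite.
    have hbound : ∀ Q : ℕ, eLpNorm (fun x => integralOperator ν k f x -
        ∑ q ∈ Finset.range Q, ev q * (∫ y, e q y * f y ∂ν) * e q x) 2 ν ≤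
        ν Set.univ ^ ((2 : ENNReal).toReal⁻¹) *
          ENNReal.ofReal (M * ‖h - ∑ q ∈ Finset.range Q, g q‖) := fun Q => by
      refine eLpNorm_le_of_ae_bound (Eventually.of_forall fun x => ?_)
      simp only [hterm]
      rw [integralOperator_eq_inner_synthesis hφ hk hfi, ← inner_sum, ← inner_sub_right]
      refine (norm_inner_le_norm _ _).trans ?_
      gcongr
      exact hM x
    refine tendsto_of_tendsto_of_tendsto_of_le_of_le tendsto_const_nhds ?_
      (fun _ => zero_le) hbound
    have h1 : Tendsto (fun Q => ENNReal.ofReal (M * ‖h - ∑ q ∈ Finset.range Q, g q‖)) atTop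
        (𝓝 0) := by
      have := ENNReal.tendsto_ofReal (hlim.const_mul M)
      simpa using this
    have h2 := ENNReal.Tendsto.const_mul (a := ν Set.univ ^ ((2 : ENNReal).toReal⁻¹)) h1
      (Or.inr (ENNReal.rpow_ne_top_of_nonneg (by positivity) (measure_ne_top ν _)))
    simpa using h2

/-- The nonzero eigenvalues are summable. -/
theorem summable_eigenvalues {ι : Type*} (hφ : Continuous φ) {Λ : ι → ℝ}
    (hnonneg : ∀ q, 0 ≤ Λ q) (b : HilbertBasis ι ℝ H)
    (hcov : ∀ q, covariance ν φ (b q) = Λ q • b q) : Summable Λ := by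
  -- The trace `∫ ‖φ‖²` bounds the partial sums, by Bessel's inequality at each point.
  refine summable_of_sum_le (c := ∫ x, ‖φ x‖ ^ 2 ∂ν) hnonneg fun s => ?_
  have h1 : ∀ q, Λ q = ∫ x, ⟪φ x, b q⟫_ℝ * ⟪φ x, b q⟫_ℝ ∂ν := fun q => by
    rw [← inner_covariance hφ, hcov, inner_smul_right, real_inner_self_eq_norm_sq,
      b.orthonormal.1]
    simp
  have hc : ∀ q, Continuous fun x => ⟪φ x, b q⟫_ℝ * ⟪φ x, b q⟫_ℝ := fun q => by fun_prop
  have hc2 : Continuous fun x => ‖φ x‖ ^ 2 := by fun_prop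
  rw [Finset.sum_congr rfl fun q _ => h1 q,
    ← integral_finsetSum _ fun q _ => (hc q).integrable_of_compactSpace]
  refine integral_mono (continuous_finsetSum _ fun q _ => hc q).integrable_of_compactSpace
    hc2.integrable_of_compactSpace fun x => ?_
  have := b.orthonormal.sum_inner_products_le (φ x) (s := s)
  refine le_trans (Finset.sum_le_sum fun q _ => ?_) this
  rw [real_inner_comm, Real.norm_eq_abs, sq_abs, sq]

end FeatureMap

/-- Positive eigenvalues tending to zero have finite multiplicity and are isolated. -/
theorem Summable.exists_clusters {ι : Type*} {Λ : ι → ℝ} (hΛ : Summable Λ) (hpos : ∀ q, 0 < Λ q) :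
    ∃ C : ι → Finset ι, (∀ p q, p ∈ C q ↔ Λ p = Λ q) ∧
      ∀ q, ∃ γ > 0, ∀ p, p ∉ C q → γ ≤ |Λ p - Λ q| := by
  have hfin : ∀ q, {p | ¬ Λ p < Λ q / 2}.Finite := fun q =>
    hΛ.tendsto_cofinite_zero.eventually_lt_const (half_pos (hpos q))
  have hC : ∀ q, ∃ C : Finset ι, ∀ p, p ∈ C ↔ Λ p = Λ q := fun q => by
    have : {p | Λ p = Λ q}.Finite := (hfin q).subset fun p (hp : Λ p = Λ q) => by
      have := hpos q
      change ¬ Λ p < Λ q / 2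
      linarith
    exact ⟨this.toFinset, fun p => by simp⟩
  choose C hC using hC
  refine ⟨C, fun p q => hC q p, fun q => ?_⟩
  -- Only finitely many eigenvalues are at least `Λ q / 2`, and each constrains `γ` by a positive
  -- number; all others are farther than `Λ q / 2` from `Λ q`.
  have h1 : ∀ᶠ γ in 𝓝[>] (0 : ℝ), ∀ p ∈ {p | ¬ Λ p < Λ q / 2}, p ∉ C q → γ ≤ |Λ p - Λ q| := by
    rw [eventually_all_finite (hfin q)]
    intro p _
    by_cases hp : p ∈ C q
    · exact Eventually.of_forall fun _ h => absurd hp h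
    · have : 0 < |Λ p - Λ q| := abs_pos.2 (sub_ne_zero.2 fun h => hp ((hC q p).2 h))
      filter_upwards [nhdsWithin_le_nhds (eventually_le_nhds this)] with γ hγ _ using hγ
  have h2 : ∀ᶠ γ in 𝓝[>] (0 : ℝ), γ ≤ Λ q / 2 :=
    nhdsWithin_le_nhds (eventually_le_nhds (half_pos (hpos q)))
  obtain ⟨γ, h1, h2, h3⟩ := (h1.and (h2.and self_mem_nhdsWithin)).exists
  refine ⟨γ, h3, fun p hp => ?_⟩
  by_cases hlt : Λ p < Λ q / 2
  · rw [abs_of_neg (by linarith [hpos q])]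
    linarith
  · exact h1 p hlt hp

end

/-! ### Grids: Gram matrices, empirical covariance and the rank bound. -/

noncomputable section

section Grid

variable {X H : Type*} [NormedAddCommGroup H] [InnerProductSpace ℝ H]

/-- The linear combination of feature vectors at the points of a grid. -/
def featureCombination (φ : X → H) {N : ℕ} (a : Fin N → X) (β : Fin N → ℝ) : H :=
  ∑ l, β l • φ (a l)

/-- The covariance operator of the uniform distribution on a grid. -/
def empiricalCovariance (φ : X → H) {N : ℕ} (a : Fin N → X) : H →L[ℝ] H :=
  (N : ℝ)⁻¹ • ∑ l, InnerProductSpace.rankOne ℝ (φ (a l)) (φ (a l))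

/-- A finite list of eigenvalues, continued by zeros. -/
def paddedEigenvalue {N : ℕ} (ℓ : Fin N → ℝ) (q : ℕ) : ℝ :=
  if h : q < N then ℓ ⟨q, h⟩ else 0

/-- The normalized eigenvectors of the empirical covariance operator, continued by zeros. -/
def paddedEigenvector (φ : X → H) {N : ℕ} (a : Fin N → X) (ℓ : Fin N → ℝ)
    (v : Fin N → Fin N → ℝ) (q : ℕ) : H :=
  if h : q < N then (√(ℓ ⟨q, h⟩))⁻¹ • featureCombination φ a (v ⟨q, h⟩) else 0

variable {φ : X → H} {k : X → X → ℝ} {N : ℕ} {a : Fin N → X} {ℓ : Fin N → ℝ}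
  {v : Fin N → Fin N → ℝ}

theorem inner_featureCombination (β : Fin N → ℝ) (x : H) :
    ⟪featureCombination φ a β, x⟫_ℝ = β ⬝ᵥ fun l => ⟪φ (a l), x⟫_ℝ := by
  simp [featureCombination, sum_inner, inner_smul_left, dotProduct]

theorem inner_featureMap_featureCombination (hk : ∀ x y, k x y = ⟪φ x, φ y⟫_ℝ) (i : Fin N)
    (β : Fin N → ℝ) : ⟪φ (a i), featureCombination φ a β⟫_ℝ = (kernelMatrix k a *ᵥ β) i := by
  simp [featureCombination, inner_sum, inner_smul_right, Matrix.mulVec, dotProduct, kernelMatrix,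
    hk, mul_comm]

theorem inner_featureCombination_featureCombination (hk : ∀ x y, k x y = ⟪φ x, φ y⟫_ℝ)
    (β β' : Fin N → ℝ) :
    ⟪featureCombination φ a β, featureCombination φ a β'⟫_ℝ = β ⬝ᵥ kernelMatrix k a *ᵥ β' := by
  rw [inner_featureCombination]
  simp only [inner_featureMap_featureCombination hk]

theorem empiricalCovariance_apply (x : H) :
    empiricalCovariance φ a x =
      (N : ℝ)⁻¹ • featureCombination φ a fun l => ⟪φ (a l), x⟫_ℝ := by
  simp [empiricalCovariance, featureCombination, _root_.sum_apply]

variable (hk : ∀ x y, k x y = ⟪φ x, φ y⟫_ℝ) (h : IsEigensystem (kernelMatrix k a) ℓ v)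

include hk h

theorem IsEigensystem.inner_featureCombination (p q : Fin N) :
    ⟪featureCombination φ a (v p), featureCombination φ a (v q)⟫_ℝ = if p = q then ℓ q else 0 := by
  rw [inner_featureCombination_featureCombination hk, h.eigen, dotProduct_smul, h.orthonormal]
  split_ifs <;> simp

theorem IsEigensystem.eigenvalue_nonneg (q : Fin N) : 0 ≤ ℓ q := by
  have := h.inner_featureCombination hk q q
  rw [if_pos rfl] at this
  rw [← this]
  exact real_inner_self_nonneg

theorem IsEigensystem.paddedEigenvalue_nonneg (q : ℕ) : 0 ≤ paddedEigenvalue ℓ q := by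
  unfold paddedEigenvalue
  split_ifs
  · exact h.eigenvalue_nonneg hk _
  · exact le_rfl

theorem IsEigensystem.paddedEigenvalue_antitone : Antitone (paddedEigenvalue ℓ) := by
  intro p q hpq
  by_cases hq : q < N
  · have hp : p < N := hpq.trans_lt hq
    simp only [paddedEigenvalue, dif_pos hp, dif_pos hq]
    exact h.antitone hpq
  · rw [paddedEigenvalue, dif_neg hq]
    exact h.paddedEigenvalue_nonneg hk p

theorem IsEigensystem.lt_rank_iff_paddedEigenvalue_pos (q : ℕ) :
    q < (kernelMatrix k a).rank ↔ 0 < paddedEigenvalue ℓ q := by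
  by_cases hq : q < N
  · rw [paddedEigenvalue, dif_pos hq]
    exact h.lt_rank_iff (h.eigenvalue_nonneg hk) ⟨q, hq⟩
  · rw [paddedEigenvalue, dif_neg hq]
    have := (kernelMatrix k a).rank_le_card_width
    rw [Fintype.card_fin] at this
    exact ⟨fun h => absurd (h.trans_le this) hq, fun h => absurd h (lt_irrefl _)⟩

/-- The Gram matrix is `V* V` and the empirical covariance is `N⁻¹ V V*`. If the eigenvalue is zero,
the padded vector is zero as well, since `(√0)⁻¹ = 0`. -/
theorem IsEigensystem.empiricalCovariance_paddedEigenvector (q : ℕ) :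
    empiricalCovariance φ a (paddedEigenvector φ a ℓ v q) =
      (paddedEigenvalue ℓ q / N) • paddedEigenvector φ a ℓ v q := by
  by_cases hq : q < N
  · simp only [paddedEigenvector, paddedEigenvalue, dif_pos hq, map_smul,
      empiricalCovariance_apply, inner_featureMap_featureCombination hk, h.eigen]
    have : featureCombination φ a (fun l => (ℓ ⟨q, hq⟩ • v ⟨q, hq⟩) l) =
        ℓ ⟨q, hq⟩ • featureCombination φ a (v ⟨q, hq⟩) := by
      simp [featureCombination, Finset.smul_sum, smul_smul]
    rw [this]
    simp only [smul_smul]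
    congr 1
    ring
  · simp [paddedEigenvector, dif_neg hq]

theorem IsEigensystem.inner_paddedEigenvector {p q : ℕ} (hp : 0 < paddedEigenvalue ℓ p)
    (hq : 0 < paddedEigenvalue ℓ q) :
    ⟪paddedEigenvector φ a ℓ v p, paddedEigenvector φ a ℓ v q⟫_ℝ = if p = q then 1 else 0 := by
  have hN : ∀ {q}, 0 < paddedEigenvalue ℓ q → q < N := fun {q} hq => by
    by_contra hcon
    rw [paddedEigenvalue, dif_neg hcon] at hq
    exact lt_irrefl _ hq
  simp only [paddedEigenvector, dif_pos (hN hp), dif_pos (hN hq), inner_smul_left,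
    inner_smul_right, conj_trivial, h.inner_featureCombination hk, Fin.mk.injEq]
  split_ifs with hpq
  · subst hpq
    rw [paddedEigenvalue, dif_pos (hN hp)] at hp
    have h1 := Real.sq_sqrt hp.le
    have h2 := (Real.sqrt_pos.2 hp).ne'
    field_simp
    exact h1.symm
  · simp

theorem IsEigensystem.featureCombination_eq_smul {q : ℕ} (hq : q < N) :
    featureCombination φ a (v ⟨q, hq⟩) =
      √(ℓ ⟨q, hq⟩) • paddedEigenvector φ a ℓ v q := by
  rw [paddedEigenvector, dif_pos hq, smul_smul]
  -- For a zero eigenvalue both sides vanish, because `‖V v_q‖² = ℓ_q`.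
  rcases (h.eigenvalue_nonneg hk ⟨q, hq⟩).eq_or_lt with h0 | h0
  · have := h.inner_featureCombination hk ⟨q, hq⟩ ⟨q, hq⟩
    rw [if_pos rfl, ← h0, inner_self_eq_zero] at this
    simp [this]
  · rw [mul_inv_cancel₀ (Real.sqrt_pos.2 h0).ne', one_smul]

/-- Upper half of the min-max principle. With `y = V* x` orthogonal to the first `q` eigenvectors,
`‖V y‖² ≤ L ‖y‖²`, while `‖y‖² = ⟪V y, x⟫ ≤ ‖V y‖ ‖x‖`; together `‖y‖² ≤ L ‖x‖²`. -/
theorem IsEigensystem.inner_empiricalCovariance_le {q : ℕ} {x : H}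
    (hx : ∀ i : Fin q, ⟪paddedEigenvector φ a ℓ v i, x⟫_ℝ = 0) :
    ⟪x, empiricalCovariance φ a x⟫_ℝ ≤ paddedEigenvalue ℓ q / N * ‖x‖ ^ 2 := by
  set y : Fin N → ℝ := fun l => ⟪φ (a l), x⟫_ℝ with hy
  set L := paddedEigenvalue ℓ q with hL
  have hL0 : 0 ≤ L := h.paddedEigenvalue_nonneg hk q
  have hvy : ∀ p : Fin N, (p : ℕ) < q → v p ⬝ᵥ y = 0 := fun p hp => by
    rw [hy, ← _root_.inner_featureCombination, h.featureCombination_eq_smul hk p.2,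
      inner_smul_left, hx ⟨p, hp⟩, mul_zero]
  have h1 : ‖featureCombination φ a y‖ ^ 2 ≤ L * (y ⬝ᵥ y) := by
    rw [← real_inner_self_eq_norm_sq, inner_featureCombination_featureCombination hk,
      h.dotProduct_mulVec_eq, ← h.sum_dotProduct_sq, Finset.mul_sum]
    refine Finset.sum_le_sum fun p _ => ?_
    by_cases hp : (p : ℕ) < q
    · simp [hvy p hp]
    · gcongr
      rw [hL, paddedEigenvalue, dif_pos ((not_lt.1 hp).trans_lt p.2)]
      exact h.antitone (not_lt.1 hp)
  have h2 : y ⬝ᵥ y ≤ ‖featureCombination φ a y‖ * ‖x‖ := by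
    rw [hy, ← _root_.inner_featureCombination]
    exact real_inner_le_norm _ _
  have hyy : 0 ≤ y ⬝ᵥ y := Finset.sum_nonneg fun _ _ => mul_self_nonneg _
  have h3 : y ⬝ᵥ y ≤ L * ‖x‖ ^ 2 := by
    rcases hyy.eq_or_lt with h0 | h0
    · rw [← h0]
      positivity
    · refine le_of_mul_le_mul_right ?_ h0
      calc (y ⬝ᵥ y) * (y ⬝ᵥ y) ≤ (‖featureCombination φ a y‖ * ‖x‖) *
            (‖featureCombination φ a y‖ * ‖x‖) := by gcongr
        _ = ‖featureCombination φ a y‖ ^ 2 * ‖x‖ ^ 2 := by ring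
        _ ≤ L * (y ⬝ᵥ y) * ‖x‖ ^ 2 := by gcongr
        _ = _ := by ring
  rw [empiricalCovariance_apply, inner_smul_right, real_inner_comm,
    _root_.inner_featureCombination, div_mul_eq_mul_div, div_eq_inv_mul]
  gcongr

/-- Weyl's inequality for the covariance operator and its empirical approximation. -/
theorem IsEigensystem.abs_sub_eigenvalue_le {ev : ℕ → ℝ} (hanti : Antitone ev)
    (hnonneg : ∀ q, 0 ≤ ev q) (b : HilbertBasis (NonzeroIndex ev) ℝ H) {A : H →L[ℝ] H}
    (hA : ∀ q, A (b q) = ev q • b q) (hAb : ∀ p x, ⟪b p, A x⟫_ℝ = ev p * ⟪b p, x⟫_ℝ)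
    {c : ℝ} (hc : 0 ≤ c) (q : NonzeroIndex ev) :
    |ev q - c * (paddedEigenvalue ℓ q / N)| ≤ ‖A - c • empiricalCovariance φ a‖ := by
  have hpos : 0 < ev q := (hnonneg q).lt_of_ne q.2.symm
  -- The eigenvalues are nonincreasing, so every index up to `q` also has a nonzero eigenvalue.
  let ι : ∀ i : ℕ, i ≤ q → NonzeroIndex ev := fun i hi => ⟨i, (hpos.trans_le (hanti hi)).ne'⟩
  have hlow : ev q ≤ c * (paddedEigenvalue ℓ q / N) + ‖A - c • empiricalCovariance φ a‖ := by
    refine le_add_norm_sub_of_orthonormal_eigenvectors (q := q)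
      (u := fun i : Fin (q + 1) => b (ι i (Nat.lt_succ_iff.1 i.2)))
      (b.orthonormal.comp _ fun i j hij => Fin.ext (congrArg Subtype.val hij))
      (fun i => hA _) (fun i => hanti (Nat.lt_succ_iff.1 i.2))
      (fun i : Fin q => paddedEigenvector φ a ℓ v i) fun x hx => ?_
    rw [_root_.smul_apply, inner_smul_right, mul_assoc]
    exact mul_le_mul_of_nonneg_left (h.inner_empiricalCovariance_le hk hx) hc
  have hup : c * (paddedEigenvalue ℓ q / N) ≤ ev q + ‖A - c • empiricalCovariance φ a‖ := by
    -- The padded eigenvectors are orthonormal only for positive eigenvalues; if the `q`-th is zero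
    -- the bound is trivial.
    rcases (h.paddedEigenvalue_nonneg hk q).eq_or_lt with h0 | h0
    · rw [← h0, zero_div, mul_zero]
      positivity
    · have hpad : ∀ i : Fin (q + 1), paddedEigenvalue ℓ q ≤ paddedEigenvalue ℓ i := fun i =>
        h.paddedEigenvalue_antitone hk (Nat.lt_succ_iff.1 i.2)
      rw [norm_sub_rev]
      refine le_add_norm_sub_of_orthonormal_eigenvectors (q := q)
        (u := fun i : Fin (q + 1) => paddedEigenvector φ a ℓ v i)
        (α := fun i => c * (paddedEigenvalue ℓ i / N)) ?_ (fun i => ?_) (fun i => ?_)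
        (fun i : Fin q => b (ι i i.2.le)) fun x hx => ?_
      · rw [orthonormal_iff_ite]
        intro i j
        rw [h.inner_paddedEigenvector hk (h0.trans_le (hpad i)) (h0.trans_le (hpad j))]
        simp only [Fin.ext_iff]
      · rw [_root_.smul_apply, h.empiricalCovariance_paddedEigenvector hk, smul_smul]
      · have := hpad i
        gcongr
      · refine hasSum_le (fun p => ?_) (b.hasSum_inner_mul_inner x (A x))
          ((b.hasSum_inner_sq x).mul_left (ev q))
        rw [hAb, real_inner_comm]
        by_cases hp : (p : ℕ) < q
        · have : ⟪b p, x⟫_ℝ = 0 := hx ⟨p, hp⟩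
          simp [this]
        · have := mul_le_mul_of_nonneg_right (hanti (not_lt.1 hp)) (sq_nonneg ⟪b p, x⟫_ℝ)
          linarith
  rw [abs_le]
  constructor <;> linarith

theorem IsEigensystem.inner_paddedEigenvector_featureCombination {q : ℕ} (hq : q < N)
    (β : Fin N → ℝ) :
    ⟪paddedEigenvector φ a ℓ v q, featureCombination φ a β⟫_ℝ =
      √(ℓ ⟨q, hq⟩) * (v ⟨q, hq⟩ ⬝ᵥ β) := by
  have hsymm : (kernelMatrix k a)ᵀ = kernelMatrix k a := by
    ext i j
    simp [kernelMatrix, hk, real_inner_comm]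
  rw [paddedEigenvector, dif_pos hq, inner_smul_left,
    inner_featureCombination_featureCombination hk, Matrix.dotProduct_mulVec,
    ← Matrix.mulVec_transpose, hsymm, h.eigen, smul_dotProduct, conj_trivial, smul_eq_mul,
    ← mul_assoc]
  congr 1
  rcases (h.eigenvalue_nonneg hk ⟨q, hq⟩).eq_or_lt with h0 | h0
  · simp [← h0]
  · rw [inv_mul_eq_div, Real.div_sqrt]

end Grid

section Rank

variable {X H : Type*} [NormedAddCommGroup H] [InnerProductSpace ℝ H] {φ : X → H}
  {k : X → X → ℝ}

/-- Parseval factors the Gram matrix through the coordinates of the feature vectors. -/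
theorem rank_kernelMatrix_le_card (hk : ∀ x y, k x y = ⟪φ x, φ y⟫_ℝ) {ι : Type*} [Fintype ι]
    (b : HilbertBasis ι ℝ H) {N : ℕ} (a : Fin N → X) :
    (kernelMatrix k a).rank ≤ Fintype.card ι := by
  have : kernelMatrix k a = (Matrix.of fun i p => ⟪φ (a i), b p⟫_ℝ) *
      Matrix.of fun p j => ⟪b p, φ (a j)⟫_ℝ := by
    ext i j
    rw [Matrix.mul_apply]
    simpa [kernelMatrix, hk] using
      (b.hasSum_inner_mul_inner (φ (a i)) (φ (a j))).unique (hasSum_fintype _)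
  rw [this]
  exact (Matrix.rank_mul_le_left _ _).trans (Matrix.rank_le_card_width _)

/-- If `ev q = 0`, all nonzero indices lie below `q`, so the basis has at most `q` elements and the
rank is at most `q`. -/
theorem eigenvalue_ne_zero_of_lt_rank (hk : ∀ x y, k x y = ⟪φ x, φ y⟫_ℝ) {ev : ℕ → ℝ}
    (hanti : Antitone ev) (hnonneg : ∀ q, 0 ≤ ev q) (b : HilbertBasis (NonzeroIndex ev) ℝ H)
    {N : ℕ} (a : Fin N → X) {q : ℕ} (hq : q < (kernelMatrix k a).rank) : ev q ≠ 0 := by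
  intro h0
  have hlt : ∀ p : NonzeroIndex ev, (p : ℕ) < q := fun p => by
    by_contra hcon
    exact p.2 (le_antisymm ((hanti (not_lt.1 hcon)).trans h0.le) (hnonneg p))
  let f : NonzeroIndex ev → Fin q := fun p => ⟨p, hlt p⟩
  have hf : Function.Injective f := fun p p' h => Subtype.ext (Fin.mk.inj h)
  have : Fintype (NonzeroIndex ev) := Fintype.ofInjective f hf
  have h1 := rank_kernelMatrix_le_card hk b a
  have h2 := Fintype.card_le_of_injective f hf
  rw [Fintype.card_fin] at h2
  omega

end Rank

end

/-! ### Operator convergence along equidistributed grids and the adapted bases. -/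

section Convergence

variable {X H : Type*} [MeasurableSpace X] [TopologicalSpace X] [CompactSpace X]
  [SecondCountableTopology X] [BorelSpace X] {ν : Measure X} [IsFiniteMeasure ν]
  [NormedAddCommGroup H] [InnerProductSpace ℝ H] [CompleteSpace H]
  {φ : X → H} {k : X → X → ℝ} {ev : ℕ → ℝ} {e : ℕ → X → ℝ}

theorem IsEquidistributed.tendsto_empiricalCovariance (hφ : Continuous φ) {N : ℕ → ℕ}
    {a : ∀ m, Fin (N m) → X} (ha : IsEquidistributed ν a) :
    Tendsto (fun m => ‖covariance ν φ - ν.real Set.univ • empiricalCovariance φ (a m)‖) atTop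
      (𝓝 0) := by
  have h1 := (ha.tendsto_average (continuous_rankOne_self hφ)).const_smul (ν.real Set.univ)
  have h2 : ν.real Set.univ • (ν.real Set.univ)⁻¹ •
      ∫ x, InnerProductSpace.rankOne ℝ (φ x) (φ x) ∂ν = covariance ν φ := by
    -- Multiplying by the total mass undoes the normalization of the average; for the zero measure
    -- both sides vanish.
    by_cases h0 : ν.real Set.univ = 0
    · have : ν = 0 := by
        rwa [measureReal_eq_zero_iff, Measure.measure_univ_eq_zero] at h0
      simp [covariance, this]
    · rw [smul_inv_smul₀ h0, covariance]
  rw [h2] at h1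
  have := (tendsto_const_nhds (x := covariance ν φ)).sub h1
  rw [sub_self] at this
  simpa [empiricalCovariance] using this.norm

/-- Along equidistributed grids, the spectral decomposition can be rotated inside the eigenspaces
such that the coefficients are approximated by those in the eigenbases of the Gram matrices. -/
theorem IsSpectralDecomposition.exists_adapted_decompositions (hφ : Continuous φ)
    (hk : ∀ x y, k x y = ⟪φ x, φ y⟫_ℝ) (hspec : IsSpectralDecomposition ν k ev e)
    (b : HilbertBasis (NonzeroIndex ev) ℝ H) (hb : ∀ q x, ⟪φ x, b q⟫_ℝ = √(ev q) * e q x)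
    (hcov : ∀ q, covariance ν φ (b q) = ev q • b q) {N : ℕ → ℕ} {a : ∀ m, Fin (N m) → X}
    (ha : IsEquidistributed ν a) {ℓ : ∀ m, Fin (N m) → ℝ} {v : ∀ m, Fin (N m) → Fin (N m) → ℝ}
    (hv : ∀ m, IsEigensystem (kernelMatrix k (a m)) (ℓ m) (v m)) :
    ∃ (e' : ℕ → ℕ → X → ℝ) (b' : ℕ → HilbertBasis (NonzeroIndex ev) ℝ H),
      (∀ m, IsSpectralDecomposition ν k ev (e' m)) ∧
      (∀ m q, ev q ≠ 0 → (∀ p, p ≠ q → ev p ≠ ev q) → e' m q = e q ∨ e' m q = -e q) ∧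
      (∀ m q x, ⟪φ x, b' m q⟫_ℝ = √(ev q) * e' m q x) ∧
      ∀ q : NonzeroIndex ev,
        (∀ᶠ m in atTop, (q : ℕ) < (kernelMatrix k (a m)).rank) ∧
        Tendsto (fun m => ‖b' m q - paddedEigenvector φ (a m) (ℓ m) (v m) q‖) atTop (𝓝 0) := by
  classical
  have hnonneg := hspec.eigenvalue_nonneg hφ hk
  have hpos : ∀ q : NonzeroIndex ev, 0 < ev q := fun q => (hnonneg q).lt_of_ne q.2.symm
  have hAb : ∀ p x, ⟪b p, covariance ν φ x⟫_ℝ = ev p * ⟪b p, x⟫_ℝ := fun p x => by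
    rw [inner_covariance_comm hφ, hcov, inner_smul_left, conj_trivial]
  obtain ⟨C, hC, hgap⟩ := (summable_eigenvalues hφ (fun q => (hpos q).le) b hcov).exists_clusters
    hpos
  have hself : ∀ q, q ∈ C q := fun q => (hC q q).2 rfl
  have hCeq : ∀ {p q}, p ∈ C q → C p = C q := fun {p q} h => by
    ext r
    rw [hC, hC, (hC p q).1 h]
  obtain ⟨O, hcol, hrow, hlim⟩ := exists_rotation_of_tendsto b hAb C hC hgap
    fun m q => paddedEigenvector φ (a m) (ℓ m) (v m) q
  let u : ℕ → NonzeroIndex ev → H := fun m q => ∑ p ∈ C q, O m p q • b p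
  have hu : ∀ m, Orthonormal ℝ (u m) := fun m => by
    rw [orthonormal_iff_ite]
    intro q q'
    simp only [u]
    by_cases hq : q ∈ C q'
    · rw [hCeq hq, b.orthonormal.inner_sum, ← hcol m q' q hq q' (hself q')]
      simp
    · have hne : q ≠ q' := fun h => hq (h ▸ hself q)
      rw [if_neg hne, sum_inner]
      refine Finset.sum_eq_zero fun p hp => ?_
      rw [inner_sum]
      refine Finset.sum_eq_zero fun p' hp' => ?_
      have : p ≠ p' := fun h => hq <| by
        rw [hC, ← (hC _ _).1 hp, h, (hC _ _).1 hp']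
      simp [inner_smul_left, inner_smul_right, b.orthonormal.2 this]
  -- Row orthogonality inverts the rotation; this makes the rotated family complete.
  have hbu : ∀ m p, b p = ∑ q ∈ C p, O m p q • u m q := fun m p => by
    have h1 : ∀ q ∈ C p, O m p q • u m q = ∑ r ∈ C p, (O m p q * O m r q) • b r := fun q hq => by
      simp only [u, hCeq hq, Finset.smul_sum, smul_smul]
    rw [Finset.sum_congr rfl h1, Finset.sum_comm]
    simp only [← Finset.sum_smul]
    rw [Finset.sum_congr rfl fun r hr => by rw [hrow m p p (hself p) r hr]]
    simp [hself p]
  have hucov : ∀ m q, covariance ν φ (u m q) = ev q • u m q := fun m q => by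
    simp only [u, map_sum, map_smul, hcov, Finset.smul_sum]
    refine Finset.sum_congr rfl fun p hp => ?_
    rw [smul_comm, (hC p q).1 hp]
  have hcomplete : ∀ m, (Submodule.span ℝ (Set.range (u m)))ᗮ = ⊥ := fun m => by
    rw [Submodule.eq_bot_iff]
    intro h hh
    rw [Submodule.mem_orthogonal] at hh
    have hperp : ∀ p, ⟪b p, h⟫_ℝ = 0 := fun p => by
      refine hh _ ?_
      rw [hbu m p]
      exact Submodule.sum_mem _ fun q _ =>
        Submodule.smul_mem _ _ (Submodule.subset_span ⟨q, rfl⟩)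
    have := b.hasSum_inner_sq h
    simp only [hperp] at this
    have h0 := this.unique ((hasSum_zero (α := ℝ)).congr_fun fun _ => zero_pow two_ne_zero)
    simpa using h0
  let b' : ℕ → HilbertBasis (NonzeroIndex ev) ℝ H := fun m =>
    HilbertBasis.mkOfOrthogonalEqBot (hu m) (hcomplete m)
  have hb'u : ∀ m q, b' m q = u m q := fun m q => by
    simp only [b', HilbertBasis.coe_mkOfOrthogonalEqBot]
  let e' : ℕ → ℕ → X → ℝ := fun m q x =>
    if hq : ev q ≠ 0 then ∑ p ∈ C ⟨q, hq⟩, O m p ⟨q, hq⟩ * e p x else 0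
  have he' : ∀ m (q : NonzeroIndex ev) x, e' m q x = ∑ p ∈ C q, O m p q * e p x :=
    fun m q x => by simp only [e', dif_pos q.2, Subtype.coe_eta]
  -- The same rotation acts on the functions, as `√(ev p)` is constant on a cluster.
  have hb' : ∀ m q x, ⟪φ x, b' m q⟫_ℝ = √(ev q) * e' m q x := fun m q x => by
    simp only [hb'u, he', u, inner_sum, inner_smul_right, hb, Finset.mul_sum]
    refine Finset.sum_congr rfl fun p hp => ?_
    rw [(hC p q).1 hp]
    ring
  have hweyl : ∀ q : NonzeroIndex ev, Tendsto
      (fun m => ν.real Set.univ * (paddedEigenvalue (ℓ m) q / N m)) atTop (𝓝 (ev q)) := fun q => by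
    rw [tendsto_iff_norm_sub_tendsto_zero]
    refine squeeze_zero (fun _ => norm_nonneg _) (fun m => ?_)
      (ha.tendsto_empiricalCovariance hφ)
    rw [norm_sub_rev]
    exact (hv m).abs_sub_eigenvalue_le hk hspec.antitone hnonneg b hcov hAb measureReal_nonneg q
  have hevpos : ∀ q : NonzeroIndex ev, ∀ᶠ m in atTop, 0 < paddedEigenvalue (ℓ m) q := fun q => by
    filter_upwards [(hweyl q).eventually_const_lt (hpos q)] with m hm
    refine ((hv m).paddedEigenvalue_nonneg hk q).lt_of_ne fun h0 => ?_
    rw [← h0] at hm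
    simp at hm
  refine ⟨e', b', fun m => ?_, fun m q hq hsimple => ?_, hb', fun q => ⟨?_, ?_⟩⟩
  · refine isSpectralDecomposition_of_hilbertBasis hφ hk hspec.antitone hnonneg (b' m) (hb' m)
      fun q => ?_
    rw [hb'u, hucov]
  · lift q to NonzeroIndex ev using hq
    -- For a simple eigenvalue the rotation is a `1 × 1` orthogonal matrix, that is, a sign.
    have hCq : C q = {q} := by
      ext p
      rw [hC, Finset.mem_singleton]
      refine ⟨fun h => ?_, fun h => h ▸ rfl⟩
      by_contra hne
      exact hsimple p (fun h => hne (Subtype.ext h)) h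
    have hO : O m q q * O m q q = 1 := by
      simpa [hCq] using hcol m q q (hself q) q (hself q)
    rcases mul_self_eq_one_iff.1 hO with h | h
    · left
      ext x
      simp [he', hCq, h]
    · right
      ext x
      simp [he', hCq, h]
  · filter_upwards [hevpos q] with m hm
    exact ((hv m).lt_rank_iff_paddedEigenvalue_pos hk q).2 hm
  · simp only [hb'u]
    refine hlim (fun m => ν.real Set.univ • empiricalCovariance φ (a m))
      (fun m q => ν.real Set.univ * (paddedEigenvalue (ℓ m) q / N m))
      (ha.tendsto_empiricalCovariance hφ) (fun q => Eventually.of_forall fun m => ?_)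
      (fun p q => ?_) hweyl q
    · rw [_root_.smul_apply, (hv m).empiricalCovariance_paddedEigenvector hk, smul_smul]
    · filter_upwards [hevpos p, hevpos q] with m hp hq
      rw [(hv m).inner_paddedEigenvector hk hp hq]
      simp only [Subtype.coe_inj]

end Convergence

/-! ### The feature map and expansions of a reproducing kernel space. -/

section ReproducingKernel

/-- Continuity follows from `‖φ y - φ x‖² = k y y - 2 k y x + k x x`. -/
theorem IsReproducingKernel.exists_featureMap {X H : Type*} [TopologicalSpace X]
    [NormedAddCommGroup H] [InnerProductSpace ℝ H] [RKHS ℝ H X ℝ] {k : X → X → ℝ}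
    (hrep : IsReproducingKernel H k) (hk : Continuous (Function.uncurry k)) :
    ∃ φ : X → H, Continuous φ ∧ (∀ x y, k x y = ⟪φ x, φ y⟫_ℝ) ∧ (∀ x (f : H), f x = ⟪φ x, f⟫_ℝ) := by
  choose φ hφk hφ using hrep
  have hkφ : ∀ x y, k x y = ⟪φ x, φ y⟫_ℝ := fun x y => by rw [← hφ, hφk]
  refine ⟨φ, continuous_iff_continuousAt.2 fun x => ?_, hkφ, hφ⟩
  rw [ContinuousAt, tendsto_iff_norm_sub_tendsto_zero]
  have h1 : ∀ y, ‖φ y - φ x‖ = √(k y y - 2 * k y x + k x x) := fun y => by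
    rw [hkφ, hkφ, hkφ, real_inner_self_eq_norm_sq, real_inner_self_eq_norm_sq,
      ← norm_sub_sq_real, Real.sqrt_sq (norm_nonneg _)]
  simp only [h1]
  have h2 : Continuous fun y => √(k y y - 2 * k y x + k x x) := by
    have hd : Continuous fun y => k y y := hk.comp (continuous_id.prodMk continuous_id)
    have hx : Continuous fun y => k y x := hk.comp (continuous_id.prodMk continuous_const)
    fun_prop
  have h3 := h2.tendsto x
  rwa [show k x x - 2 * k x x + k x x = 0 by ring, Real.sqrt_zero] at h3

/-- Elements of `H` are determined by their values, so the vectors in an expansion must be the basis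
`b`, and the coefficients are its Fourier coefficients. -/
theorem hasExpansion_iff {X H : Type*} [NormedAddCommGroup H] [InnerProductSpace ℝ H]
    [RKHS ℝ H X ℝ] {ev : ℕ → ℝ} {e : ℕ → X → ℝ} (b : HilbertBasis (NonzeroIndex ev) ℝ H)
    (hb : ∀ q x, b q x = √(ev q) * e q x) {χ : H} {μ : NonzeroIndex ev → ℝ} :
    HasExpansion ev e χ μ ↔ ∀ q, μ q = ⟪b q, χ⟫_ℝ := by
  classical
  constructor
  · rintro ⟨u, hu, hsum⟩ q
    have hub : u = b := by
      ext q x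
      rw [hu, hb]
    subst hub
    have h1 := hsum.mapL (innerSL ℝ (b q))
    simp only [innerSL_apply_apply, inner_smul_right, orthonormal_iff_ite.1 b.orthonormal] at h1
    have h2 := hasSum_ite_eq q (μ q)
    refine h2.unique (h1.congr_fun fun p => ?_)
    by_cases hpq : p = q
    · simp [hpq]
    · simp [hpq, Ne.symm hpq]
  · intro h
    refine ⟨b, hb, ?_⟩
    have := b.hasSum_repr χ
    simpa only [b.repr_apply_apply, ← h] using this

end ReproducingKernel

/-! ### Lebesgue measure on `E`, and the main theorem. -/

section Lebesgue

variable {n : ℕ} {E : Set (EuclideanSpace ℝ (Fin n))}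

theorem isFiniteMeasure_lebesgueOn (hE : IsCompact E) : IsFiniteMeasure (lebesgueOn E) := by
  refine ⟨?_⟩
  rw [comap_subtype_coe_apply hE.measurableSet, Set.image_univ, Subtype.range_coe]
  exact hE.measure_lt_top

theorem isOpenPosMeasure_lebesgueOn (hE : IsCompact E)
    (hsupp : ∀ U : Set (EuclideanSpace ℝ (Fin n)), IsOpen U → (E ∩ U).Nonempty →
      0 < volume (E ∩ U)) : (lebesgueOn E).IsOpenPosMeasure := by
  refine ⟨fun U hU hne => ?_⟩
  obtain ⟨V, hV, rfl⟩ := isOpen_induced_iff.1 hU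
  rw [comap_subtype_coe_apply hE.measurableSet, Subtype.image_preimage_coe]
  obtain ⟨x, hx⟩ := hne
  exact (hsupp V hV ⟨x, x.2, hx⟩).ne'

end Lebesgue

theorem theorem3 {n : ℕ} (E : Set (EuclideanSpace ℝ (Fin n))) (hE : IsCompact E)
    (hsupp : ∀ U : Set (EuclideanSpace ℝ (Fin n)), IsOpen U → (E ∩ U).Nonempty →
      0 < volume (E ∩ U))
    (k : E → E → ℝ) (hk : Continuous (Function.uncurry k))
    {H : Type*} [NormedAddCommGroup H] [InnerProductSpace ℝ H] [CompleteSpace H] [RKHS ℝ H E ℝ]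
    (hrep : IsReproducingKernel H k)
    (ev : ℕ → ℝ) (e : ℕ → E → ℝ) (hspec : IsSpectralDecomposition (lebesgueOn E) k ev e) :
    -- the functions `√(ev q) • e q` form an orthonormal basis of the space
    (∃ b : HilbertBasis (NonzeroIndex ev) ℝ H, ∀ q x, b q x = √(ev q) * e q x) ∧
    -- every element has a unique expansion, which also holds at every point
    (∀ χ : H, ∃! μ : NonzeroIndex ev → ℝ, HasExpansion ev e χ μ) ∧
    (∀ (χ : H) (μ : NonzeroIndex ev → ℝ), HasExpansion ev e χ μ →
      ∀ x, HasSum (fun q : NonzeroIndex ev => μ q * (√(ev q) * e q x)) (χ x)) ∧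
    -- the inner product in terms of the coefficients
    (∀ (χ₁ χ₂ : H) (μ₁ μ₂ : NonzeroIndex ev → ℝ),
      HasExpansion ev e χ₁ μ₁ → HasExpansion ev e χ₂ μ₂ →
      HasSum (fun q => μ₁ q * μ₂ q) ⟪χ₁, χ₂⟫_ℝ) ∧
    -- a Gram matrix has no more nonzero eigenvalues than the integral operator
    (∀ (N : ℕ) (a : Fin N → E) (q : ℕ), q < (kernelMatrix k a).rank → ev q ≠ 0) ∧
    -- approximation of the first `d = rank` coefficients from the eigenpairs of the Gram matrix
    (∀ (N : ℕ → ℕ) (a : ∀ m, Fin (N m) → E), IsEquidistributed (lebesgueOn E) a →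
      ∀ (ℓ : ∀ m, Fin (N m) → ℝ) (v : ∀ m, Fin (N m) → Fin (N m) → ℝ),
      (∀ m, IsEigensystem (kernelMatrix k (a m)) (ℓ m) (v m)) →
      ∃ e' : ℕ → ℕ → E → ℝ,
        (∀ m, IsSpectralDecomposition (lebesgueOn E) k ev (e' m)) ∧
        (∀ m q, ev q ≠ 0 → (∀ p, p ≠ q → ev p ≠ ev q) → e' m q = e q ∨ e' m q = -e q) ∧
        ∀ q : NonzeroIndex ev,
          (∀ᶠ m in atTop, (q : ℕ) < (kernelMatrix k (a m)).rank) ∧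
          ∀ ε : ℝ, 0 < ε → ∀ᶠ m in atTop, ∀ hq : (q : ℕ) < N m,
            (q : ℕ) < (kernelMatrix k (a m)).rank →
            ∀ (β : Fin (N m) → ℝ) (χ : H) (μ : NonzeroIndex ev → ℝ),
              (∀ x, χ x = ∑ l, β l * k x (a m l)) → HasExpansion ev (e' m) χ μ →
              |μ q - √(ℓ m ⟨q, hq⟩) * (v m ⟨q, hq⟩ ⬝ᵥ β)| ≤ ε * ‖χ‖) := by
  have : CompactSpace E := isCompact_iff_compactSpace.1 hE
  have := isFiniteMeasure_lebesgueOn hE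
  have := isOpenPosMeasure_lebesgueOn hE hsupp
  obtain ⟨φ, hφ, hkφ, heval⟩ := hrep.exists_featureMap hk
  obtain ⟨b, hb, hcov⟩ := hspec.exists_hilbertBasis hφ hkφ fun f hf =>
    RKHS.ext fun x => by rw [heval, hf, RKHS.coe_zero, Pi.zero_apply]
  have hbe : ∀ q x, b q x = √(ev q) * e q x := fun q x => by rw [heval, hb]
  have hexp : ∀ {χ : H} {μ : NonzeroIndex ev → ℝ}, HasExpansion ev e χ μ ↔ ∀ q, μ q = ⟪b q, χ⟫_ℝ :=
    hasExpansion_iff b hbe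
  refine ⟨⟨b, hbe⟩, fun χ => ⟨fun q => ⟪b q, χ⟫_ℝ, hexp.2 fun _ => rfl, fun μ hμ =>
    funext (hexp.1 hμ)⟩, fun χ μ ⟨u, hu, hsum⟩ x => ?_, fun χ₁ χ₂ μ₁ μ₂ h₁ h₂ => ?_,
    fun N a q => eigenvalue_ne_zero_of_lt_rank hkφ hspec.antitone
      (hspec.eigenvalue_nonneg hφ hkφ) b a, fun N a ha ℓ v hv => ?_⟩
  · have h1 := hsum.mapL (innerSL ℝ (φ x))
    simp only [innerSL_apply_apply, inner_smul_right] at h1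
    simpa only [← heval, hu] using h1
  · refine (b.hasSum_inner_mul_inner χ₁ χ₂).congr_fun fun q => ?_
    rw [hexp.1 h₁, hexp.1 h₂, real_inner_comm]
  · obtain ⟨e', b', hspec', hsimple, hb', hlim⟩ :=
      hspec.exists_adapted_decompositions hφ hkφ b hb hcov ha hv
    refine ⟨e', hspec', hsimple, fun q => ⟨(hlim q).1, fun ε hε => ?_⟩⟩
    filter_upwards [(hlim q).2.eventually_le_const hε] with m hm hq hrank β χ μ hχ hμ
    have hχβ : χ = featureCombination φ (a m) β := by
      ext x
      rw [hχ, heval, featureCombination, inner_sum]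
      simp only [inner_smul_right, hkφ]
    -- The error equals `⟪b' m q - w_q, χ⟫`, with `w_q` the padded eigenvector; since `hm` does not
    -- involve `β`, the bound is uniform in `β`.
    rw [(hasExpansion_iff (b' m) fun q x => by rw [heval, hb']).1 hμ q,
      ← (hv m).inner_paddedEigenvector_featureCombination hkφ hq, ← hχβ, ← inner_sub_left]
    refine (abs_real_inner_le_norm _ _).trans ?_
    gcongr
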